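/- Let $d\ge 1$ and let $\nu$ be a Lévy measure on $\mathbb R^d$, i.e. a measure with $\nu(\{0\})=0$ and $\int (1\wedge|z|^2)\,\nu(dz)<\infty$. Let $(X_t)_{t\ge0}$ be a Lévy process on $\mathbb R^d$ with $\mathbb E\, e^{i\langle\xi,X_t\rangle}=e^{-t\Phi(\xi)}$ for all $t\ge 0$ and $\xi\in\mathbb R^d$, where $$\Phi(\xi)=\int_{z\ne0}\bigl(1-e^{i\langle\xi,z\rangle}+i\langle\xi,z\rangle\mathbf 1_{B(0,1)}(z)\bigr)\,\nu(dz).$$ For bounded Borel measurable $u:\mathbb R^d\to\mathbb R$ put $P_tu(x)=\mathbb E\,u(x+X_t)$, $\|u\|_\infty=\sup_x|u(x)|$, $|\nabla u(x)|=\limsup_{y\to x}\frac{|u(y)-u(x)|}{|y-x|}$ and $\|\nabla u\|_\infty=\sup_x|\nabla u(x)|$. Write $g\asymp h$ if $c_1g\le h\le c_2g$ for some constants $c_1,c_2>0$. Assume that $$\liminf_{|\xi|\to\infty}\frac{\operatorname{Re}\Phi(\xi)}{\log(1+|\xi|)}=\infty .$$ (1) Let $f:[0,\infty)\to\mathbb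 R$ be strictly increasing and differentiable near infinity, with $$\limsup_{s\to\infty}\frac{f^{-1}(2s)}{f^{-1}(s)}<\infty\qquad\text{and}\qquad \operatorname{Re}\Phi(\xi)\asymp f(|\xi|)\ \text{ as } |\xi|\to\infty .$$ Then there are constants $c,t_0>0$ such that for all $0<t\le t_0$ and all bounded Borel measurable $u$, $$\|\nabla P_tu\|_\infty\le c\,\|u\|_\infty\,f^{-1}(1/t).$$ (2) Let $f:[0,\infty)\to\mathbb R$ be strictly increasing and differentiable near zero (on some interval $(0,\varepsilon)$), with $$\liminf_{r\to0}f(r)\,|\log r|<\infty,\qquad \limsup_{s\to0}\frac{f^{-1}(2s)}{f^{-1}(s)}<\infty\qquad\text{and}\qquad \operatorname{Re}\Phi(\xi)\asymp f(|\xi|)\ \text{ as } |\xi|\to0 .$$ Then there are constants $c,t_1>0$ such that for all $t\ge t_1$ and all bounded Borel measurable $u$, $$\|\nabla P_tu\|_\infty\le c\,\|u\|_\infty\,f^{-1}(1/t).$$ -/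

import Mathlib

open Filter Topology MeasureTheory ProbabilityTheory
open scoped ENNReal NNReal

/-- A Lévy measure on `ℝ^d`: a measure without mass at the origin which integrates `1 ∧ |z|²`.
(Such a measure is automatically σ-finite.) -/
structure IsLevyMeasure {d : ℕ} (ν : Measure (EuclideanSpace ℝ (Fin d))) : Prop where
  zero_singleton : ν {0} = 0
  lintegral_lt_top : ∫⁻ z, ENNReal.ofReal (min 1 (‖z‖ ^ 2)) ∂ν < ∞

/-- The symbol (characteristic exponent) with Lévy measure `ν`, without Gaussian part:
`Φ(ξ) = ∫ (1 - e^{i⟨ξ,z⟩} + i⟨ξ,z⟩ 1_{B(0,1)}(z)) ν(dz)`. -/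
noncomputable def levySymbol {d : ℕ} (ν : Measure (EuclideanSpace ℝ (Fin d)))
    (ξ : EuclideanSpace ℝ (Fin d)) : ℂ :=
  ∫ z, (1 - Complex.exp (Complex.I * ((inner ℝ ξ z : ℝ) : ℂ))
    + (Metric.ball (0 : EuclideanSpace ℝ (Fin d)) 1).indicator
        (fun z => Complex.I * ((inner ℝ ξ z : ℝ) : ℂ)) z) ∂ν

/-- A Lévy process on `ℝ^d`: started at `0`, with independent and stationary increments and
almost surely right-continuous paths with left limits. -/
structure IsLevyProcess {d : ℕ} {Ω : Type*} [MeasurableSpace Ω] (P : Measure Ω)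
    (X : ℝ≥0 → Ω → EuclideanSpace ℝ (Fin d)) : Prop where
  measurable : ∀ t, Measurable (X t)
  zero : ∀ᵐ ω ∂P, X 0 ω = 0
  indep : HasIndepIncrements X P
  stationary : ∀ s t, IdentDistrib (fun ω => X (s + t) ω - X s ω) (X t) P P
  cadlag : ∀ᵐ ω ∂P, ∀ t, ContinuousWithinAt (fun s => X s ω) (Set.Ici t) t ∧
    ∃ l, Tendsto (fun s => X s ω) (𝓝[<] t) (𝓝 l)

/-- `X` has the symbol `Φ`: `E e^{i⟨ξ, X_t⟩} = e^{-t Φ(ξ)}`. -/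
def HasSymbol {d : ℕ} {Ω : Type*} [MeasurableSpace Ω] (P : Measure Ω)
    (X : ℝ≥0 → Ω → EuclideanSpace ℝ (Fin d)) (Φ : EuclideanSpace ℝ (Fin d) → ℂ) : Prop :=
  ∀ (t : ℝ≥0) (ξ : EuclideanSpace ℝ (Fin d)),
    charFun (P.map (X t)) ξ = Complex.exp (-((t : ℝ) : ℂ) * Φ ξ)

/-- The semigroup of the Lévy process `X`: `P_t u(x) = E u(x + X_t)`. -/
noncomputable def levySemigroup {d : ℕ} {Ω : Type*} [MeasurableSpace Ω] (P : Measure Ω)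
    (X : ℝ≥0 → Ω → EuclideanSpace ℝ (Fin d)) (t : ℝ≥0)
    (u : EuclideanSpace ℝ (Fin d) → ℝ) (x : EuclideanSpace ℝ (Fin d)) : ℝ :=
  ∫ ω, u (x + X t ω) ∂P

/-- `|∇u(x)| = limsup_{y → x} |u(y) - u(x)| / |y - x|`, with values in `[0, ∞]`. -/
noncomputable def gradAbs {d : ℕ} (u : EuclideanSpace ℝ (Fin d) → ℝ)
    (x : EuclideanSpace ℝ (Fin d)) : ℝ≥0∞ :=
  limsup (fun y => ENNReal.ofReal (|u y - u x| / ‖y - x‖)) (𝓝[≠] x)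

/-- `‖∇u‖_∞ = sup_x |∇u(x)|`, with values in `[0, ∞]`. -/
noncomputable def gradSupNorm {d : ℕ} (u : EuclideanSpace ℝ (Fin d) → ℝ) : ℝ≥0∞ :=
  ⨆ x, gradAbs u x

/-- `‖u‖_∞ = sup_x |u(x)|`, with values in `[0, ∞]`. -/
noncomputable def supNorm {d : ℕ} (u : EuclideanSpace ℝ (Fin d) → ℝ) : ℝ≥0∞ :=
  ⨆ x, ENNReal.ofReal |u x|

/-- `u ∈ B_b(ℝ^d)`: bounded and Borel measurable. -/
def IsBoundedBorel {d : ℕ} (u : EuclideanSpace ℝ (Fin d) → ℝ) : Prop :=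
  Measurable u ∧ ∃ M : ℝ, ∀ x, |u x| ≤ M

/-- `liminf_{|ξ| → ∞} Re Φ(ξ) / log (1 + |ξ|) = ∞`. -/
def HartmanWintner {d : ℕ} (Φ : EuclideanSpace ℝ (Fin d) → ℂ) : Prop :=
  liminf (fun ξ => (((Φ ξ).re / Real.log (1 + ‖ξ‖) : ℝ) : EReal))
    (Bornology.cobounded (EuclideanSpace ℝ (Fin d))) = ⊤

/-- `g ≍ h` along the filter `l`: `c₁ g ≤ h ≤ c₂ g` for some constants `c₁, c₂ > 0`. -/
def AsympComparable {α : Type*} (l : Filter α) (g h : α → ℝ) : Prop :=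
  ∃ c₁ > 0, ∃ c₂ > 0, ∀ᶠ x in l, c₁ * g x ≤ h x ∧ h x ≤ c₂ * g x

/-- The inverse `f⁻¹` of a strictly increasing function `f : [0, ∞) → ℝ`: for `s` in the range of
`f` this is the unique `r ≥ 0` with `f r = s`. -/
noncomputable def rayInv (f : ℝ → ℝ) : ℝ → ℝ :=
  Function.invFunOn f (Set.Ici 0)

/-- Conditions on a strictly increasing `f : [0, ∞) → ℝ` at infinity, including
`Re Φ(ξ) ≍ f(|ξ|)` as `|ξ| → ∞`. -/
structure ControlsAtInfinity {d : ℕ} (Φ : EuclideanSpace ℝ (Fin d) → ℂ) (f : ℝ → ℝ) : Prop where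
  strictMono : StrictMonoOn f (Set.Ici 0)
  differentiable : ∀ᶠ r in atTop, DifferentiableAt ℝ f r
  doubling : limsup (fun s => ((rayInv f (2 * s) / rayInv f s : ℝ) : EReal)) atTop < ⊤
  comparable : AsympComparable (Bornology.cobounded (EuclideanSpace ℝ (Fin d)))
    (fun ξ => (Φ ξ).re) (fun ξ => f ‖ξ‖)

/-- Conditions on a strictly increasing `f : [0, ∞) → ℝ` near zero, including
`Re Φ(ξ) ≍ f(|ξ|)` as `|ξ| → 0`. -/
structure ControlsAtZero {d : ℕ} (Φ : EuclideanSpace ℝ (Fin d) → ℂ) (f : ℝ → ℝ) : Prop where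
  strictMono : StrictMonoOn f (Set.Ici 0)
  differentiable : ∀ᶠ r in 𝓝[>] (0 : ℝ), DifferentiableAt ℝ f r
  log_bound : liminf (fun r => ((f r * |Real.log r| : ℝ) : EReal)) (𝓝[>] (0 : ℝ)) < ⊤
  doubling : limsup (fun s => ((rayInv f (2 * s) / rayInv f s : ℝ) : EReal)) (𝓝[>] (0 : ℝ)) < ⊤
  comparable : AsympComparable (𝓝[≠] (0 : EuclideanSpace ℝ (Fin d)))
    (fun ξ => (Φ ξ).re) (fun ξ => f ‖ξ‖)

/-! Suppose the characteristic function of a law is the product of the Fourier transform of `g` and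
the characteristic function of a probability measure `ρ`, where `g` and its gradient decay
integrably. Then the law has density `Re g ∗ ρ`, and shifting a bounded `u` by a small `a` changes
its integral by at most a constant times `‖a‖ ‖u‖_∞`; no regularity of `ρ` is needed. It suffices to
find such a factorisation for `R X_t`, `R = f⁻¹(1/t)`, with constants independent of `t`: undoing
the scaling produces the factor `R`.

Up to a drift, `R X_t` has symbol `t Φ(R ·)`. Its jumps below size one have a smooth symbol `ψ`, and
every derivative of `ψ` of order at least one is at most `1 + ‖η‖` times their second moment. Hence
`e^{-ψ}` is the transform of a good kernel once `e^{-Re ψ}` decays fast enough (`exists_kernel`).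
The larger jumps form a compound Poisson law, which together with the drift gives `ρ`. Two bounds
make this uniform: `t Re Φ(Rξ) ≤ A` for `‖ξ‖ ≤ 1`, which controls the second moment of the small
jumps and the mass of the large ones (`IsLevyMeasure.integral_sq_smallJumps_le`,
`IsLevyMeasure.bigJumps_univ_le`), and `e^{-t Re Φ(Rξ)} (1 + ‖ξ‖)^{2d+3} ≤ K`.

Both bounds come from `f` (the two `exists_scale_bounds`). The first rests on monotonicity and `t
f(R) = 1`. For the second, doubling of `f⁻¹` means `2 f(r) ≤ f(C r)`, so `f(r) / f(R)` grows at
least like a power of `r / R`, and its negative exponential beats every power. For large `t` this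
covers only low frequencies. Beyond a fixed radius half of the exponent, bounded below by positivity
of `Re Φ` there, pays for passing from scale `R` to that radius, and the other half uses the
Hartman–Wintner condition. -/

/-! ### Smoothness of the symbol of the small jumps -/

section SmallJumps

variable {V : Type*} [NormedAddCommGroup V] [InnerProductSpace ℝ V]

lemma continuous_innerSL_smulRight {E : Type*} [NormedAddCommGroup E] [NormedSpace ℝ E] {T : V → E}
    (hT : Continuous T) : Continuous fun z : V => (innerSL ℝ z).smulRight (T z) := by
  have : Continuous fun z : V => ContinuousLinearMap.smulRightL ℝ V E (innerSL ℝ z) (T z) := by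
    fun_prop
  exact this

section Deriv

variable {E : Type*} [NormedAddCommGroup E] [NormedSpace ℝ E] [NormedSpace ℂ E]
  [IsScalarTower ℝ ℂ E]

/-- Differentiation under the integral sign for integrals of ridge functions. -/
lemma hasFDerivAt_integral_comp_inner [FiniteDimensional ℝ V] [MeasurableSpace V] [BorelSpace V]
    {κ : Measure V} {k k' : ℝ → ℂ} (hk : ∀ a, HasDerivAt k (k' a) a) (hk' : Continuous k')
    {T : V → E} (hT : Continuous T) {η : V} {bound : V → ℝ} (hb : Integrable bound κ)
    (hbound : ∀ η' ∈ Metric.ball η 1, ∀ z, ‖k' (inner ℝ η' z)‖ * (‖z‖ * ‖T z‖) ≤ bound z)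
    (hint : Integrable (fun z => k (inner ℝ η z) • T z) κ) :
    HasFDerivAt (fun η => ∫ z, k (inner ℝ η z) • T z ∂κ)
      (∫ z, k' (inner ℝ η z) • (innerSL ℝ z).smulRight (T z) ∂κ) η := by
  have hkc : Continuous k := continuous_iff_continuousAt.2 fun a => (hk a).continuousAt
  have hS := continuous_innerSL_smulRight hT
  refine hasFDerivAt_integral_of_dominated_of_fderiv_le (F := fun η z => k (inner ℝ η z) • T z)
    (F' := fun η z => k' (inner ℝ η z) • (innerSL ℝ z).smulRight (T z)) (bound := bound)
    (Metric.ball_mem_nhds η one_pos) ?_ hint ?_ ?_ hb ?_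
  · filter_upwards with x
    exact ((hkc.comp (by fun_prop : Continuous fun z : V => inner ℝ x z)).smul
      hT).aestronglyMeasurable
  · exact ((hk'.comp (by fun_prop : Continuous fun z : V => inner ℝ η z)).smul
      hS).aestronglyMeasurable
  · filter_upwards with z x hx
    rw [norm_smul, ContinuousLinearMap.norm_smulRight_apply, innerSL_apply_norm]
    exact hbound x hx z
  · filter_upwards with z x _
    have h1 : HasFDerivAt (fun η : V => inner ℝ η z) (innerSL ℝ z) x := by
      have := (innerSL ℝ z).hasFDerivAt (x := x)
      simpa [innerSL_apply_apply, real_inner_comm] using this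
    have h2 := (hk (inner ℝ x z)).hasFDerivAt.comp x h1
    have h3 := h2.smul_const (T z)
    refine h3.congr_fderiv ?_
    ext v
    have h4 : (inner ℝ z v) • T z = ((inner ℝ z v : ℝ) : ℂ) • T z :=
      (algebraMap_smul ℂ (inner ℝ z v : ℝ) (T z)).symm
    simp only [ContinuousLinearMap.smulRight_apply, ContinuousLinearMap.comp_apply,
      ContinuousLinearMap.toSpanSingleton_apply, _root_.smul_apply,
      innerSL_apply_apply, h4, smul_smul, Complex.real_smul, mul_comm]

end Deriv

/-- The characteristic exponent with Lévy measure `κ` and all jumps compensated. -/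
noncomputable def compensatedSymbol [MeasurableSpace V] (κ : Measure V) (η : V) : ℂ :=
  ∫ z, (1 - Complex.exp (Complex.I * ((inner ℝ η z : ℝ) : ℂ))
    + Complex.I * ((inner ℝ η z : ℝ) : ℂ)) ∂κ

lemma hasDerivAt_exp_I_mul (a : ℝ) :
    HasDerivAt (fun a : ℝ => Complex.exp (Complex.I * a))
      (Complex.I * Complex.exp (Complex.I * a)) a := by
  have h : HasDerivAt (fun a : ℝ => Complex.I * (a : ℂ)) Complex.I a := by
    simpa using (Complex.ofRealCLM.hasDerivAt (x := a)).const_mul Complex.I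
  simpa [mul_comm] using h.cexp

lemma hasDerivAt_compensated_exp (a : ℝ) :
    HasDerivAt (fun a : ℝ => 1 - Complex.exp (Complex.I * a) + Complex.I * a)
      (Complex.I * (1 - Complex.exp (Complex.I * a))) a := by
  have h : HasDerivAt (fun a : ℝ => Complex.I * (a : ℂ)) Complex.I a := by
    simpa using (Complex.ofRealCLM.hasDerivAt (x := a)).const_mul Complex.I
  exact (((hasDerivAt_const a (1 : ℂ)).sub (hasDerivAt_exp_I_mul a)).add h).congr_deriv (by ring)

lemma hasDerivAt_I_mul_one_sub_exp (a : ℝ) :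
    HasDerivAt (fun a : ℝ => Complex.I * (1 - Complex.exp (Complex.I * a)))
      (Complex.exp (Complex.I * a)) a := by
  refine (((hasDerivAt_const a (1 : ℂ)).sub (hasDerivAt_exp_I_mul a)).const_mul
    Complex.I).congr_deriv ?_
  linear_combination (-Complex.exp (Complex.I * a)) * Complex.I_sq

lemma norm_I_mul_one_sub_exp_le (a : ℝ) :
    ‖Complex.I * (1 - Complex.exp (Complex.I * a))‖ ≤ |a| := by
  rw [norm_mul, Complex.norm_I, one_mul, norm_sub_rev]
  exact Real.norm_exp_I_mul_ofReal_sub_one_le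

lemma norm_compensated_exp_le (a : ℝ) :
    ‖1 - Complex.exp (Complex.I * a) + Complex.I * a‖ ≤ a ^ 2 := by
  have h := Convex.norm_image_sub_le_of_norm_hasDerivWithin_le (C := |a|) (s := Set.uIcc 0 a)
    (f := fun a : ℝ => 1 - Complex.exp (Complex.I * a) + Complex.I * a)
    (f' := fun a : ℝ => Complex.I * (1 - Complex.exp (Complex.I * a)))
    (fun x _ => (hasDerivAt_compensated_exp x).hasDerivWithinAt) ?_ (convex_uIcc 0 a)
    Set.left_mem_uIcc Set.right_mem_uIcc
  · simpa [← sq] using h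
  · intro x hx
    refine (norm_I_mul_one_sub_exp_le x).trans ?_
    simpa using Set.abs_sub_left_of_mem_uIcc hx

lemma abs_inner_mul_le_of_mem_ball {η η' : V} (h : η' ∈ Metric.ball η 1) (z : V) :
    |inner ℝ η' z| ≤ (‖η‖ + 1) * ‖z‖ := by
  refine (abs_real_inner_le_norm η' z).trans ?_
  gcongr
  have h1 := norm_sub_norm_le η' η
  rw [mem_ball_iff_norm] at h
  linarith

/-- The pairing for which the Fourier kernel `𝐞 (-angularPairing z η)` is `e^{i⟨η,z⟩}`. -/
noncomputable def angularPairing : V →L[ℝ] V →L[ℝ] ℝ := (-(2 * Real.pi)⁻¹ : ℝ) • innerSL ℝ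

lemma angularPairing_apply (z η : V) :
    angularPairing z η = -((2 * Real.pi)⁻¹ * inner ℝ z η) := by
  simp [angularPairing]
  rfl

/-- Each derivative of a Fourier integral costs a factor `2π` times the norm of the pairing; this
normalisation makes that factor harmless. -/
lemma norm_angularPairing_le : 2 * Real.pi * ‖(angularPairing : V →L[ℝ] V →L[ℝ] ℝ)‖ ≤ 1 := by
  have hpi := Real.pi_pos
  have h : ‖(angularPairing : V →L[ℝ] V →L[ℝ] ℝ)‖ ≤ (2 * Real.pi)⁻¹ := by
    refine ContinuousLinearMap.opNorm_le_bound₂ _ (by positivity) fun x y => ?_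
    rw [angularPairing_apply, norm_neg, norm_mul, Real.norm_of_nonneg (by positivity), mul_assoc]
    gcongr
    exact norm_inner_le_norm x y
  calc _ ≤ 2 * Real.pi * (2 * Real.pi)⁻¹ := by gcongr
    _ = 1 := by field_simp

/-- The bilinear form `z ⊗ z`, with complex values. -/
noncomputable def tensorSq (z : V) : V →L[ℝ] V →L[ℝ] ℂ :=
  (innerSL ℝ z).smulRight ((innerSL ℝ z).smulRight (1 : ℂ))

lemma norm_tensorSq (z : V) : ‖tensorSq z‖ = ‖z‖ ^ 2 := by
  simp [tensorSq, sq]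

lemma continuous_tensorSq : Continuous (tensorSq : V → V →L[ℝ] V →L[ℝ] ℂ) :=
  continuous_innerSL_smulRight (continuous_innerSL_smulRight continuous_const)

variable [MeasurableSpace V] {κ : Measure V}

/-- The derivative of `compensatedSymbol`. -/
noncomputable def compensatedSymbolDeriv (κ : Measure V) (η : V) : V →L[ℝ] ℂ :=
  ∫ z, (Complex.I * (1 - Complex.exp (Complex.I * ((inner ℝ η z : ℝ) : ℂ)))) •
    (innerSL ℝ z).smulRight (1 : ℂ) ∂κ

lemma norm_compensatedSymbolDeriv_le (hκ : Integrable (fun z => ‖z‖ ^ 2) κ) (η : V) :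
    ‖compensatedSymbolDeriv κ η‖ ≤ ‖η‖ * ∫ z, ‖z‖ ^ 2 ∂κ := by
  rw [← integral_const_mul]
  refine norm_integral_le_of_norm_le (hκ.const_mul _) ?_
  filter_upwards with z
  rw [norm_smul, ContinuousLinearMap.norm_smulRight_apply, innerSL_apply_norm, norm_one, mul_one]
  calc _ ≤ (‖η‖ * ‖z‖) * ‖z‖ := by
        gcongr
        exact (norm_I_mul_one_sub_exp_le _).trans (abs_real_inner_le_norm η z)
    _ = _ := by ring

variable [FiniteDimensional ℝ V] [BorelSpace V]

lemma integrable_compensated_exp (hκ : Integrable (fun z => ‖z‖ ^ 2) κ) (η : V) :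
    Integrable (fun z => 1 - Complex.exp (Complex.I * ((inner ℝ η z : ℝ) : ℂ))
      + Complex.I * ((inner ℝ η z : ℝ) : ℂ)) κ := by
  refine (hκ.const_mul (‖η‖ ^ 2)).mono' (by fun_prop) ?_
  filter_upwards with z
  refine (norm_compensated_exp_le _).trans ?_
  rw [← mul_pow, ← sq_abs]
  gcongr
  exact abs_real_inner_le_norm η z

lemma hasFDerivAt_compensatedSymbol (hκ : Integrable (fun z => ‖z‖ ^ 2) κ) (η : V) :
    HasFDerivAt (compensatedSymbol κ) (compensatedSymbolDeriv κ η) η := by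
  have h := hasFDerivAt_integral_comp_inner (κ := κ) (T := fun _ : V => (1 : ℂ)) (η := η)
    (bound := fun z => (‖η‖ + 1) * ‖z‖ ^ 2) hasDerivAt_compensated_exp (by fun_prop)
    continuous_const (hκ.const_mul _) ?_ ?_
  · simp only [smul_eq_mul, mul_one] at h
    exact h
  · intro η' h z
    calc _ ≤ ((‖η‖ + 1) * ‖z‖) * (‖z‖ * ‖(1 : ℂ)‖) := by
          gcongr
          exact (norm_I_mul_one_sub_exp_le _).trans (abs_inner_mul_le_of_mem_ball h z)
      _ = _ := by simp; ring
  · simpa using integrable_compensated_exp hκ η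

/-- The second derivative of `compensatedSymbol`, as a Fourier integral. -/
noncomputable def compensatedSymbolDerivTwo (κ : Measure V) : V → (V →L[ℝ] V →L[ℝ] ℂ) :=
  VectorFourier.fourierIntegral Real.fourierChar κ
    angularPairing.toLinearMap₁₂ tensorSq

/-- Two derivatives remove the compensation and leave the Fourier integral of `z ⊗ z`. All higher
derivatives then come from the theory of Fourier integrals. -/
lemma hasFDerivAt_compensatedSymbolDeriv (hκ : Integrable (fun z => ‖z‖ ^ 2) κ) (η : V) :
    HasFDerivAt (compensatedSymbolDeriv κ) (compensatedSymbolDerivTwo κ η) η := by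
  have h := hasFDerivAt_integral_comp_inner (κ := κ)
    (T := fun z : V => (innerSL ℝ z).smulRight (1 : ℂ)) (η := η)
    (bound := fun z => ‖z‖ ^ 2) hasDerivAt_I_mul_one_sub_exp (by fun_prop)
    (continuous_innerSL_smulRight continuous_const) hκ ?_ ?_
  · refine h.congr_fderiv ?_
    unfold compensatedSymbolDerivTwo VectorFourier.fourierIntegral
    congr 1
    ext1 z
    have : -(angularPairing (V := V)).toLinearMap₁₂ z η
        = (2 * Real.pi)⁻¹ * inner ℝ η z := by
      simp [angularPairing_apply, real_inner_comm]
    rw [this, Circle.smul_def, Real.fourierChar_apply]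
    congr 2
    have := Real.pi_ne_zero
    push_cast
    field_simp
  · intro η' h z
    rw [mul_comm Complex.I, Complex.norm_exp_ofReal_mul_I, ContinuousLinearMap.norm_smulRight_apply]
    simp [sq]
  · refine (hκ.const_mul (‖η‖)).mono' (Continuous.aestronglyMeasurable ?_) ?_
    · exact (by fun_prop : Continuous fun z : V =>
        Complex.I * (1 - Complex.exp (Complex.I * ((inner ℝ η z : ℝ) : ℂ)))).smul
        (continuous_innerSL_smulRight continuous_const)
    · filter_upwards with z
      rw [norm_smul, ContinuousLinearMap.norm_smulRight_apply, innerSL_apply_norm, norm_one,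
        mul_one]
      calc _ ≤ (‖η‖ * ‖z‖) * ‖z‖ := by
            gcongr
            exact (norm_I_mul_one_sub_exp_le _).trans (abs_real_inner_le_norm η z)
        _ = _ := by ring

lemma integrable_pow_mul_norm_tensorSq (hκ : Integrable (fun z => ‖z‖ ^ 2) κ)
    (hball : ∀ᵐ z ∂κ, ‖z‖ ≤ 1) (n : ℕ) : Integrable (fun z => ‖z‖ ^ n * ‖tensorSq z‖) κ := by
  refine hκ.mono' (by simp only [norm_tensorSq]; fun_prop) ?_
  filter_upwards [hball] with z hz
  rw [norm_tensorSq, Real.norm_of_nonneg (by positivity)]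
  exact mul_le_of_le_one_left (by positivity) (pow_le_one₀ (norm_nonneg z) hz)

lemma contDiff_compensatedSymbol (hκ : Integrable (fun z => ‖z‖ ^ 2) κ)
    (hball : ∀ᵐ z ∂κ, ‖z‖ ≤ 1) (N : ℕ) : ContDiff ℝ N (compensatedSymbol κ) := by
  have h2 : ContDiff ℝ N (compensatedSymbolDerivTwo κ) :=
    VectorFourier.contDiff_fourierIntegral (N := N) _
      fun n _ => integrable_pow_mul_norm_tensorSq hκ hball n
  have e1 : fderiv ℝ (compensatedSymbol κ) = compensatedSymbolDeriv κ :=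
    funext fun η => (hasFDerivAt_compensatedSymbol hκ η).fderiv
  have e2 : fderiv ℝ (compensatedSymbolDeriv κ) = compensatedSymbolDerivTwo κ :=
    funext fun η => (hasFDerivAt_compensatedSymbolDeriv hκ η).fderiv
  have h1 : ContDiff ℝ (N + 1) (compensatedSymbolDeriv κ) :=
    contDiff_succ_iff_fderiv.2 ⟨fun η => (hasFDerivAt_compensatedSymbolDeriv hκ η).differentiableAt,
      by simp, e2 ▸ h2⟩
  have h0 : ContDiff ℝ (N + 1 + 1) (compensatedSymbol κ) :=
    contDiff_succ_iff_fderiv.2 ⟨fun η => (hasFDerivAt_compensatedSymbol hκ η).differentiableAt,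
      by simp, e1 ▸ h1⟩
  exact h0.of_le (le_self_add.trans le_self_add)

/-- The first derivative grows linearly, since `|1 - e^{ia}| ≤ |a|`. From order two on there is no
growth: each further derivative brings down a factor `‖z‖ ≤ 1`, so the second moment suffices. -/
lemma norm_iteratedFDeriv_compensatedSymbol_le (hκ : Integrable (fun z => ‖z‖ ^ 2) κ)
    (hball : ∀ᵐ z ∂κ, ‖z‖ ≤ 1) {n : ℕ} (hn : 1 ≤ n) (η : V) :
    ‖iteratedFDeriv ℝ n (compensatedSymbol κ) η‖ ≤ (1 + ‖η‖) * ∫ z, ‖z‖ ^ 2 ∂κ := by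
  have hA : 0 ≤ ∫ z, ‖z‖ ^ 2 ∂κ := integral_nonneg fun _ => by positivity
  have e1 : fderiv ℝ (compensatedSymbol κ) = compensatedSymbolDeriv κ :=
    funext fun η => (hasFDerivAt_compensatedSymbol hκ η).fderiv
  have e2 : fderiv ℝ (compensatedSymbolDeriv κ) = compensatedSymbolDerivTwo κ :=
    funext fun η => (hasFDerivAt_compensatedSymbolDeriv hκ η).fderiv
  obtain ⟨m, rfl⟩ := Nat.exists_eq_add_of_le' hn
  rw [← norm_iteratedFDeriv_fderiv, e1]
  rcases m with _ | n
  · rw [norm_iteratedFDeriv_zero]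
    refine (norm_compensatedSymbolDeriv_le hκ η).trans ?_
    gcongr
    linarith
  · rw [← norm_iteratedFDeriv_fderiv, e2]
    unfold compensatedSymbolDerivTwo
    have hm : AEStronglyMeasurable (tensorSq : V → V →L[ℝ] V →L[ℝ] ℂ) κ :=
      continuous_tensorSq.aestronglyMeasurable
    have key := VectorFourier.iteratedFDeriv_fourierIntegral (μ := κ) (N := n) (n := n)
      (f := (tensorSq : V → V →L[ℝ] V →L[ℝ] ℂ))
      (angularPairing (V := V))
      (fun n _ => integrable_pow_mul_norm_tensorSq hκ hball n)
      hm le_rfl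
    rw [key]
    refine (VectorFourier.norm_fourierIntegral_le_integral_norm _ _ _ _ _).trans ?_
    calc _ ≤ ∫ z, ‖z‖ ^ 2 ∂κ := by
          refine integral_mono_of_nonneg (ae_of_all _ fun _ => norm_nonneg _) hκ ?_
          filter_upwards [hball] with z hz
          refine (VectorFourier.norm_fourierPowSMulRight_le _ _ _ _).trans ?_
          rw [norm_tensorSq]
          exact mul_le_of_le_one_left (by positivity) (mul_le_one₀
            (pow_le_one₀ (by positivity) norm_angularPairing_le) (by positivity)
            (pow_le_one₀ (norm_nonneg z) hz))
      _ ≤ _ := le_mul_of_one_le_left hA (by linarith [norm_nonneg η])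

end SmallJumps

/-- The real derivative of `exp` is `exp` followed by the multiplication map, which has operator
norm at most one, so no constant accumulates in the induction. -/
lemma norm_iteratedFDeriv_cexp_le (n : ℕ) (z : ℂ) :
    ‖iteratedFDeriv ℝ n Complex.exp z‖ ≤ Real.exp z.re := by
  induction n with
  | zero => rw [norm_iteratedFDeriv_zero, Complex.norm_exp]
  | succ n ih =>
    have h : fderiv ℝ Complex.exp = ContinuousLinearMap.mul ℝ ℂ ∘ Complex.exp := by
      ext1 x
      have h1 := ((Complex.hasDerivAt_exp x).hasFDerivAt.restrictScalars ℝ).fderiv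
      rw [h1]
      ext1 v
      simp [mul_comm]
    rw [← norm_iteratedFDeriv_fderiv, h]
    refine (ContinuousLinearMap.norm_iteratedFDeriv_comp_left (n := n) (N := n) _
      (Complex.contDiff_exp (𝕜 := ℝ)).contDiffAt le_rfl).trans ?_
    exact (mul_le_of_le_one_left (norm_nonneg _) (ContinuousLinearMap.opNorm_mul_le ℝ ℂ)).trans ih

/-! ### The kernel of the small jumps -/

section Kernel

variable {V : Type*} [NormedAddCommGroup V] [InnerProductSpace ℝ V] [FiniteDimensional ℝ V]
  [MeasurableSpace V] [BorelSpace V]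

lemma contDiff_exp_neg_compensatedSymbol {κ : Measure V} (hκ : Integrable (fun z => ‖z‖ ^ 2) κ)
    (hball : ∀ᵐ z ∂κ, ‖z‖ ≤ 1) (N : ℕ) :
    ContDiff ℝ N fun η => Complex.exp (-compensatedSymbol κ η) :=
  (contDiff_compensatedSymbol hκ hball N).neg.cexp

/-- Faà di Bruno bound `n! C Dⁿ` with `C = e^{-Re ψ}` and `D = (1 + A)(1 + ‖η‖)`. As `D ≥ 1`, the
bound `D` on each derivative of `ψ` is also a bound `D ^ i`. -/
lemma norm_iteratedFDeriv_exp_neg_compensatedSymbol_le {κ : Measure V}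
    (hκ : Integrable (fun z => ‖z‖ ^ 2) κ) (hball : ∀ᵐ z ∂κ, ‖z‖ ≤ 1) {A : ℝ}
    (hA : ∫ z, ‖z‖ ^ 2 ∂κ ≤ A) (n : ℕ) (η : V) :
    ‖iteratedFDeriv ℝ n (fun η => Complex.exp (-compensatedSymbol κ η)) η‖ ≤
      n.factorial * Real.exp (-(compensatedSymbol κ η).re) * ((1 + A) * (1 + ‖η‖)) ^ n := by
  have hA0 : 0 ≤ A := (integral_nonneg fun _ => by positivity).trans hA
  refine norm_iteratedFDeriv_comp_le (g := Complex.exp) (f := fun η => -compensatedSymbol κ η)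
    (N := n) Complex.contDiff_exp (contDiff_compensatedSymbol hκ hball n).neg le_rfl η ?_ ?_
  · intro i _
    simpa using norm_iteratedFDeriv_cexp_le i (-compensatedSymbol κ η)
  · intro i hi _
    have hD : 1 ≤ (1 + A) * (1 + ‖η‖) :=
      one_le_mul_of_one_le_of_one_le (by linarith) (by linarith [norm_nonneg η])
    have : (fun η => -compensatedSymbol κ η) = -compensatedSymbol κ := rfl
    rw [this, iteratedFDeriv_neg, Pi.neg_apply, norm_neg]
    calc _ ≤ (1 + ‖η‖) * ∫ z, ‖z‖ ^ 2 ∂κ :=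
          norm_iteratedFDeriv_compensatedSymbol_le hκ hball hi η
      _ ≤ (1 + ‖η‖) * (1 + A) := by gcongr; linarith
      _ = (1 + A) * (1 + ‖η‖) := mul_comm _ _
      _ ≤ _ := le_self_pow₀ hD (by omega)

lemma integrable_inv_one_add_norm_pow :
    Integrable fun v : V => ((1 + ‖v‖) ^ (Module.finrank ℝ V + 1))⁻¹ := by
  have h := integrable_one_add_norm (E := V) (μ := volume) (r := (Module.finrank ℝ V + 1 : ℕ))
    (by push_cast; linarith)
  refine h.congr (ae_of_all _ fun v => ?_)
  have : 0 ≤ 1 + ‖v‖ := by positivity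
  simp only [Real.rpow_neg this, Real.rpow_natCast]

/-- Integrable kernels with integrable gradient whose Fourier transform is the exponential of a
compensated symbol; the bounds depend only on the second moment of the Lévy measure and on the
decay of the exponential. -/
lemma exists_kernel (A K : ℝ) :
    ∃ C, ∀ κ : Measure V, Integrable (fun z => ‖z‖ ^ 2) κ → (∀ᵐ z ∂κ, ‖z‖ ≤ 1) →
      ∫ z, ‖z‖ ^ 2 ∂κ ≤ A →
      (∀ η, Real.exp (-(compensatedSymbol κ η).re) *
        (1 + ‖η‖) ^ (2 * Module.finrank ℝ V + 3) ≤ K) →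
      ∃ g : V → ℂ, ContDiff ℝ 1 g ∧
        (∀ w, ‖g w‖ ≤ C * ((1 + ‖w‖) ^ (Module.finrank ℝ V + 1))⁻¹) ∧
        (∀ w, ‖fderiv ℝ g w‖ ≤ C * ((1 + ‖w‖) ^ (Module.finrank ℝ V + 1))⁻¹) ∧
        ∀ η, ∫ w, Complex.exp (((2 * Real.pi * inner ℝ w η : ℝ) : ℂ) * Complex.I) * g w =
          Complex.exp (-compensatedSymbol κ η) := by
  set d := Module.finrank ℝ V with hd
  set J : ℝ := ∫ v : V, ((1 + ‖v‖) ^ (d + 1))⁻¹ with hJ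
  have hJ0 : 0 ≤ J := integral_nonneg fun _ => by positivity
  set M : ℝ := (d + 1).factorial * (1 + A) ^ (d + 1) * K with hM
  -- The constant `(2π)^k (2k+2)^n` of the Fourier decay estimate, times the `(k+1)(n+1)` integrals
  -- occurring in it, at the extreme values `k = 1`, `n = d + 1`.
  set C₁ : ℝ := (2 * Real.pi) * 4 ^ (d + 1) * (2 * (d + 2) * (M * J)) with hC₁
  refine ⟨2 ^ d * (2 * C₁), fun κ hκ hball hA hK => ?_⟩
  have hA0 : 0 ≤ A := (integral_nonneg fun _ => by positivity).trans hA
  have hK0 : 0 ≤ K := le_trans (by positivity) (hK 0)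
  have hM0 : 0 ≤ M := by positivity
  set F : V → ℂ := fun η => Complex.exp (-compensatedSymbol κ η) with hF
  have hFc : ContDiff ℝ ((d + 1 : ℕ) : ℕ∞) F := contDiff_exp_neg_compensatedSymbol hκ hball (d + 1)
  -- Of the `2d + 3` powers of decay, up to `k + n ≤ d + 2` absorb the weight and the growth of the
  -- derivatives; the remaining `d + 1` give integrability.
  have hbound : ∀ k n : ℕ, k ≤ 1 → n ≤ d + 1 → ∀ v,
      ‖v‖ ^ k * ‖iteratedFDeriv ℝ n F v‖ ≤ M * ((1 + ‖v‖) ^ (d + 1))⁻¹ := by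
    intro k n hk hn v
    have h1 : 1 ≤ 1 + ‖v‖ := by linarith [norm_nonneg v]
    have hfac : (n.factorial : ℝ) ≤ (d + 1).factorial := by exact_mod_cast Nat.factorial_le hn
    have hpow : (1 + ‖v‖) ^ (k + n) ≤ (1 + ‖v‖) ^ (d + 2) := pow_le_pow_right₀ h1 (by omega)
    have hApow : (1 + A) ^ n ≤ (1 + A) ^ (d + 1) := pow_le_pow_right₀ (by linarith) hn
    calc _ ≤ (1 + ‖v‖) ^ k * (n.factorial * Real.exp (-(compensatedSymbol κ v).re) *
            ((1 + A) * (1 + ‖v‖)) ^ n) := by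
          gcongr
          · linarith
          · exact norm_iteratedFDeriv_exp_neg_compensatedSymbol_le hκ hball hA n v
      _ = n.factorial * (1 + A) ^ n * (Real.exp (-(compensatedSymbol κ v).re)
            * (1 + ‖v‖) ^ (k + n)) := by rw [mul_pow, pow_add]; ring
      _ ≤ (d + 1).factorial * (1 + A) ^ (d + 1) * (Real.exp (-(compensatedSymbol κ v).re)
            * (1 + ‖v‖) ^ (d + 2)) := by
          gcongr
      _ = (d + 1).factorial * (1 + A) ^ (d + 1) * ((Real.exp (-(compensatedSymbol κ v).re)
            * (1 + ‖v‖) ^ (2 * d + 3)) * ((1 + ‖v‖) ^ (d + 1))⁻¹) := by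
          rw [show 2 * d + 3 = (d + 2) + (d + 1) by ring, pow_add _ (d + 2) (d + 1)]
          field_simp
      _ ≤ (d + 1).factorial * (1 + A) ^ (d + 1) * (K * ((1 + ‖v‖) ^ (d + 1))⁻¹) := by
          gcongr
          exact hK v
      _ = _ := by rw [hM]; ring
  have hInt : ∀ k n : ℕ, k ≤ 1 → n ≤ d + 1 →
      Integrable fun v => ‖v‖ ^ k * ‖iteratedFDeriv ℝ n F v‖ := by
    intro k n hk hn
    refine (integrable_inv_one_add_norm_pow.const_mul M).mono'
      (Continuous.aestronglyMeasurable ?_) (ae_of_all _ fun v => ?_)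
    · exact (continuous_norm.pow k).mul
        (hFc.continuous_iteratedFDeriv (m := n) (by exact_mod_cast hn)).norm
    · rw [Real.norm_of_nonneg (by positivity)]
      exact hbound k n hk hn v
  have hInt' : ∀ k n : ℕ, (k : ℕ∞) ≤ (1 : ℕ) → (n : ℕ∞) ≤ (d + 1 : ℕ) →
      Integrable fun v => ‖v‖ ^ k * ‖iteratedFDeriv ℝ n F v‖ := fun k n hk hn =>
    hInt k n (by exact_mod_cast hk) (by exact_mod_cast hn)
  have hint_le : ∀ k n : ℕ, k ≤ 1 → n ≤ d + 1 →
      ∫ v, ‖v‖ ^ k * ‖iteratedFDeriv ℝ n F v‖ ≤ M * J := by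
    intro k n hk hn
    rw [hJ, ← integral_const_mul]
    exact integral_mono (hInt k n hk hn) (integrable_inv_one_add_norm_pow.const_mul M)
      (hbound k n hk hn)
  set g : V → ℂ := FourierTransform.fourier F with hg
  have hgb : ∀ k n : ℕ, k ≤ 1 → n ≤ d + 1 → ∀ w, ‖w‖ ^ n * ‖iteratedFDeriv ℝ k g w‖ ≤ C₁ := by
    intro k n hk hn w
    refine (Real.pow_mul_norm_iteratedFDeriv_fourier_le (K := (1 : ℕ)) (N := (d + 1 : ℕ)) hFc hInt'
      (by exact_mod_cast hk) (by exact_mod_cast hn) w).trans ?_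
    have hpi : 1 ≤ 2 * Real.pi := by linarith [Real.two_le_pi]
    have hk' : (k : ℝ) ≤ 1 := by exact_mod_cast hk
    rw [hC₁]
    gcongr
    · exact (pow_le_pow_right₀ hpi hk).trans_eq (pow_one _)
    · calc (2 * (k : ℝ) + 2) ^ n ≤ 4 ^ n := by gcongr; linarith
        _ ≤ _ := pow_le_pow_right₀ (by norm_num) hn
    · calc _ ≤ ∑ p ∈ Finset.range (k + 1) ×ˢ Finset.range (n + 1), M * J := by
            refine Finset.sum_le_sum fun p hp => ?_
            simp only [Finset.mem_product, Finset.mem_range] at hp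
            exact hint_le _ _ (by omega) (by omega)
        _ = (((k + 1) * (n + 1) : ℕ) : ℝ) * (M * J) := by simp
        _ ≤ ((2 * (d + 2) : ℕ) : ℝ) * (M * J) := by
            gcongr ?_ * (M * J)
            exact_mod_cast Nat.mul_le_mul (by omega) (by omega)
        _ = _ := by push_cast; ring
  have hgdecay : ∀ k : ℕ, k ≤ 1 → ∀ w,
      ‖iteratedFDeriv ℝ k g w‖ ≤ 2 ^ d * (2 * C₁) * ((1 + ‖w‖) ^ (d + 1))⁻¹ := by
    intro k hk w
    rw [← div_eq_mul_inv, le_div_iff₀ (by positivity)]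
    -- The weights `1` and `‖w‖ ^ (d + 1)` together dominate `(1 + ‖w‖) ^ (d + 1)` up to the factor
    -- `2 ^ d`.
    have h0 := hgb k 0 hk (by omega) w
    have h1 := hgb k (d + 1) hk le_rfl w
    rw [pow_zero, one_mul] at h0
    calc _ ≤ ‖iteratedFDeriv ℝ k g w‖ * (2 ^ d * (1 ^ (d + 1) + ‖w‖ ^ (d + 1))) := by
          gcongr
          simpa using add_pow_le zero_le_one (norm_nonneg w) (d + 1)
      _ = 2 ^ d * (‖iteratedFDeriv ℝ k g w‖ + ‖w‖ ^ (d + 1) * ‖iteratedFDeriv ℝ k g w‖) := by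
          rw [one_pow]; ring
      _ ≤ _ := by gcongr; linarith
  have hgc : ContDiff ℝ 1 g := by
    have := Real.contDiff_fourier (f := F) (N := (1 : ℕ)) fun n hn => by
      simpa using hInt n 0 (by exact_mod_cast hn) (by omega)
    exact_mod_cast this
  have hg0 : ∀ w, ‖g w‖ ≤ 2 ^ d * (2 * C₁) * ((1 + ‖w‖) ^ (d + 1))⁻¹ := fun w => by
    simpa using hgdecay 0 (by omega) w
  refine ⟨g, hgc, hg0, fun w => ?_, fun η => ?_⟩
  · have h := hgdecay 1 le_rfl w
    rwa [← norm_iteratedFDeriv_fderiv (n := 0), norm_iteratedFDeriv_zero] at h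
  · have hFint : Integrable F := by
      have := hInt 0 0 (by omega) (by omega)
      simp only [pow_zero, one_mul, norm_iteratedFDeriv_zero] at this
      exact (integrable_norm_iff hFc.continuous.aestronglyMeasurable).1 this
    have hgint : Integrable g :=
      (integrable_inv_one_add_norm_pow.const_mul _).mono' hgc.continuous.aestronglyMeasurable
        (ae_of_all _ hg0)
    -- `g` is the Fourier transform of `F`, so inversion returns `F`.
    have h := congrFun (hFc.continuous.fourierInv_fourier_eq hFint hgint) η
    rw [Real.fourierInv_eq'] at h
    simpa [hg, hF] using h

end Kernel

/-! ### Compound Poisson distributions -/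

section CompoundPoisson

variable {V : Type*} [NormedAddCommGroup V] [InnerProductSpace ℝ V]
  [MeasurableSpace V] [BorelSpace V] [SecondCountableTopology V]

/-- The `n`-th convolution power of a measure. -/
noncomputable def convPow (l : Measure V) : ℕ → Measure V
  | 0 => Measure.dirac 0
  | n + 1 => (convPow l n).conv l

instance isFiniteMeasure_convPow (l : Measure V) [IsFiniteMeasure l] (n : ℕ) :
    IsFiniteMeasure (convPow l n) := by
  induction n with
  | zero => unfold convPow; infer_instance
  | succ n ih => unfold convPow; infer_instance

lemma charFun_convPow (l : Measure V) [IsFiniteMeasure l] (n : ℕ) (ξ : V) :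
    charFun (convPow l n) ξ = charFun l ξ ^ n := by
  induction n with
  | zero => simp [convPow]
  | succ n ih => rw [convPow, charFun_conv, ih, pow_succ]

/-- The total mass is the value of the characteristic function at zero. -/
lemma convPow_univ (l : Measure V) [IsFiniteMeasure l] (n : ℕ) :
    convPow l n Set.univ = ENNReal.ofReal (l.real Set.univ ^ n) := by
  have h := charFun_convPow l n 0
  rw [charFun_zero, charFun_zero] at h
  rw [← ofReal_measureReal]
  congr 1
  exact_mod_cast h

/-- The compound Poisson distribution with (finite) Lévy measure `l`. -/
noncomputable def compoundPoisson (l : Measure V) : Measure V :=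
  Measure.sum fun n : ℕ =>
    ENNReal.ofReal (Real.exp (-l.real Set.univ) * (n.factorial : ℝ)⁻¹) • convPow l n

instance isProbabilityMeasure_compoundPoisson (l : Measure V) [IsFiniteMeasure l] :
    IsProbabilityMeasure (compoundPoisson l) := by
  refine ⟨?_⟩
  set L := l.real Set.univ with hL
  have hL0 : 0 ≤ L := measureReal_nonneg
  have hs : HasSum (fun n : ℕ => Real.exp (-L) * (n.factorial : ℝ)⁻¹ * L ^ n) 1 := by
    have h := (NormedSpace.expSeries_div_hasSum_exp L).mul_left (Real.exp (-L))
    rw [← Real.exp_eq_exp_ℝ, ← Real.exp_add, neg_add_cancel, Real.exp_zero] at h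
    refine h.congr_fun ?_
    intro n
    ring
  rw [compoundPoisson, Measure.sum_apply _ MeasurableSet.univ]
  simp only [Measure.smul_apply, convPow_univ, smul_eq_mul, ← hL]
  have : ∀ n : ℕ, ENNReal.ofReal (Real.exp (-L) * (n.factorial : ℝ)⁻¹) * ENNReal.ofReal (L ^ n)
      = ENNReal.ofReal (Real.exp (-L) * (n.factorial : ℝ)⁻¹ * L ^ n) := fun n =>
    (ENNReal.ofReal_mul (by positivity)).symm
  simp only [this]
  rw [← ENNReal.ofReal_tsum_of_nonneg (fun n => by positivity) hs.summable, hs.tsum_eq,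
    ENNReal.ofReal_one]

lemma charFun_compoundPoisson (l : Measure V) [IsFiniteMeasure l] (ξ : V) :
    charFun (compoundPoisson l) ξ = Complex.exp (charFun l ξ - l.real Set.univ) := by
  have hint : Integrable (fun x : V => Complex.exp (inner ℝ x ξ * Complex.I))
      (compoundPoisson l) := by
    refine (integrable_const (1 : ℝ)).mono' (by fun_prop) (ae_of_all _ fun x => ?_)
    rw [Complex.norm_exp_ofReal_mul_I]
  have h1 := hasSum_integral_measure hint
  have h2 := (NormedSpace.expSeries_div_hasSum_exp (charFun l ξ)).mul_left
    (Complex.exp (-l.real Set.univ))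
  rw [← Complex.exp_eq_exp_ℂ, ← Complex.exp_add, neg_add_eq_sub] at h2
  refine h1.unique (h2.congr_fun ?_)
  intro n
  rw [integral_smul_measure, ENNReal.toReal_ofReal (by positivity)]
  change _ • charFun (convPow l n) ξ = _
  rw [charFun_convPow, Complex.real_smul]
  push_cast
  ring

end CompoundPoisson

/-! ### Translations of laws with a smooth factor -/

section Translation

variable {V : Type*} [NormedAddCommGroup V] [InnerProductSpace ℝ V]

/-- A function with decaying gradient is Lipschitz for small translations, in a way that is
integrable in space. -/
lemma norm_comp_sub_sub_le {g : V → ℂ} {C : ℝ} {n : ℕ} (hg : ContDiff ℝ 1 g)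
    (hDg : ∀ w, ‖fderiv ℝ g w‖ ≤ C * ((1 + ‖w‖) ^ n)⁻¹) {a : V} (ha : ‖a‖ ≤ 1) (y : V) :
    ‖g (y - a) - g y‖ ≤ C * 2 ^ n * ((1 + ‖y‖) ^ n)⁻¹ * ‖a‖ := by
  have hC : 0 ≤ C := by
    have := (norm_nonneg _).trans (hDg 0)
    simpa using this
  have h := Convex.norm_image_sub_le_of_norm_fderiv_le (𝕜 := ℝ) (f := g)
    (s := Metric.closedBall y ‖a‖) (C := C * 2 ^ n * ((1 + ‖y‖) ^ n)⁻¹) (x := y) (y := y - a)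
    (fun x _ => hg.differentiable one_ne_zero x) ?_ (convex_closedBall y ‖a‖)
    (Metric.mem_closedBall_self (norm_nonneg a)) (by simp)
  · simpa using h
  · intro x hx
    refine (hDg x).trans ?_
    rw [mem_closedBall_iff_norm'] at hx
    -- Since `‖x - y‖ ≤ ‖a‖ ≤ 1`, moving the weight from `x` to `y` costs at most a factor 2 per
    -- power.
    have h1 : 1 + ‖y‖ ≤ 2 * (1 + ‖x‖) := by
      have := norm_sub_norm_le y x
      linarith [norm_nonneg x]
    have h2 : (1 + ‖y‖) ^ n ≤ 2 ^ n * (1 + ‖x‖) ^ n := by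
      rw [← mul_pow]
      gcongr
    rw [mul_assoc]
    gcongr
    rw [inv_eq_one_div, div_le_iff₀ (by positivity), mul_assoc, mul_comm _ ((1 + ‖x‖) ^ n),
      ← mul_assoc, ← div_eq_mul_inv, le_div_iff₀ (by positivity), one_mul]
    exact h2

variable [FiniteDimensional ℝ V] [MeasurableSpace V] [BorelSpace V]

lemma integral_norm_comp_sub_sub_le {g : V → ℂ} {C : ℝ} (hg : ContDiff ℝ 1 g)
    (hDg : ∀ w, ‖fderiv ℝ g w‖ ≤ C * ((1 + ‖w‖) ^ (Module.finrank ℝ V + 1))⁻¹)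
    {a : V} (ha : ‖a‖ ≤ 1) :
    ∫ y, ‖g (y - a) - g y‖ ≤ C * 2 ^ (Module.finrank ℝ V + 1) *
      (∫ y : V, ((1 + ‖y‖) ^ (Module.finrank ℝ V + 1))⁻¹) * ‖a‖ := by
  rw [← integral_const_mul, ← integral_mul_const]
  exact integral_mono_of_nonneg (ae_of_all _ fun _ => norm_nonneg _)
    ((integrable_inv_one_add_norm_pow.const_mul _).mul_const _)
    (ae_of_all _ fun y => norm_comp_sub_sub_le hg hDg ha y)

/-- Integration against the difference of positive and negative part of a density. -/
lemma integral_withDensity_sub_neg {E : Type*} [NormedAddCommGroup E] [NormedSpace ℝ E]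
    {q : V → ℝ} (hq : Measurable q) (hqi : Integrable q) {φ : V → E} {M : ℝ}
    (hφ : AEStronglyMeasurable φ) (hM : ∀ x, ‖φ x‖ ≤ M) :
    ∫ x, φ x ∂(volume.withDensity fun x => ENNReal.ofReal (q x)) -
      ∫ x, φ x ∂(volume.withDensity fun x => ENNReal.ofReal (-q x)) = ∫ x, q x • φ x := by
  rw [integral_withDensity_eq_integral_toReal_smul (by fun_prop) (by simp),
    integral_withDensity_eq_integral_toReal_smul (by fun_prop) (by simp)]
  have hb : ∀ p : V → ℝ, Integrable p → Integrable fun x => p x • φ x := fun p hp =>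
    hp.smul_bdd M hφ (ae_of_all _ hM)
  rw [← integral_sub]
  · refine integral_congr_ae (ae_of_all _ fun x => ?_)
    simp only [← sub_smul, ENNReal.toReal_ofReal']
    rw [max_zero_sub_max_neg_zero_eq_self]
  · simp only [ENNReal.toReal_ofReal']
    exact hb _ hqi.pos_part
  · simp only [ENNReal.toReal_ofReal']
    exact hb _ hqi.neg_part

lemma isFiniteMeasure_withDensity_ofReal_of_integrable {q : V → ℝ} (hqi : Integrable q) :
    IsFiniteMeasure (volume.withDensity fun x => ENNReal.ofReal (q x)) :=
  isFiniteMeasure_withDensity_ofReal hqi.2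

/-- If the characteristic function of `μ` is the product of the Fourier transform of `g` and of the
characteristic function of `ρ`, then `μ` has the real part of `g ∗ ρ` as its density. -/
lemma integral_eq_integral_re_mul {g : V → ℂ} (hg : Measurable g) (hgi : Integrable g)
    {μ ρ : Measure V} [IsProbabilityMeasure μ] [IsProbabilityMeasure ρ]
    (hchar : ∀ ξ, charFun μ ξ =
      (∫ w, Complex.exp (((inner ℝ w ξ : ℝ) : ℂ) * Complex.I) * g w) * charFun ρ ξ)
    {u : V → ℝ} (hu : Measurable u) {M : ℝ} (hM : ∀ x, |u x| ≤ M) :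
    ∫ x, u x ∂μ = ∫ x, (g x).re * ∫ y, u (x + y) ∂ρ := by
  set q : V → ℝ := fun x => (g x).re with hq
  have hqm : Measurable q := Complex.measurable_re.comp hg
  have hqi : Integrable q := hgi.re
  set m₁ := volume.withDensity fun x => ENNReal.ofReal (q x) with hm₁
  set m₂ := volume.withDensity fun x => ENNReal.ofReal (-q x) with hm₂
  have : IsFiniteMeasure m₁ := isFiniteMeasure_withDensity_ofReal_of_integrable hqi
  have : IsFiniteMeasure m₂ := isFiniteMeasure_withDensity_ofReal_of_integrable hqi.neg
  have hexp : ∀ ξ x : V, ‖Complex.exp (((inner ℝ x ξ : ℝ) : ℂ) * Complex.I)‖ ≤ 1 := fun ξ x => by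
    rw [Complex.norm_exp_ofReal_mul_I]
  -- The kernel may be replaced by its real part: average the factorisation at `ξ` with its
  -- conjugate at `-ξ`. Characteristic functions are unchanged by this, while `g` becomes `(g + conj
  -- g) / 2`.
  have hdiff : ∀ ξ, charFun μ ξ = (charFun m₁ ξ - charFun m₂ ξ) * charFun ρ ξ := by
    intro ξ
    have h1 : charFun m₁ ξ - charFun m₂ ξ =
        ∫ x, q x • Complex.exp (((inner ℝ x ξ : ℝ) : ℂ) * Complex.I) :=
      integral_withDensity_sub_neg hqm hqi (by fun_prop) (hexp ξ)
    have h2 := hchar ξ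
    have h3 := congrArg (starRingEnd ℂ) (hchar (-ξ))
    rw [map_mul, charFun_neg, charFun_neg, Complex.conj_conj, Complex.conj_conj,
      ← integral_conj] at h3
    have hbi : ∀ p : V → ℂ, Integrable p →
        Integrable fun w => Complex.exp (((inner ℝ w ξ : ℝ) : ℂ) * Complex.I) * p w := fun p hp =>
      hp.bdd_mul (c := 1) (by fun_prop) (ae_of_all _ (hexp ξ))
    have hci : Integrable fun w => (starRingEnd ℂ) (g w) :=
      Complex.conjLIE.toContinuousLinearEquiv.toContinuousLinearMap.integrable_comp hgi
    have h4 : (∫ w, Complex.exp (((inner ℝ w ξ : ℝ) : ℂ) * Complex.I) * g w) +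
        (∫ w, (starRingEnd ℂ) (Complex.exp (((inner ℝ w (-ξ) : ℝ) : ℂ) * Complex.I) * g w)) =
        2 * (charFun m₁ ξ - charFun m₂ ξ) := by
      have e : ∀ w, (starRingEnd ℂ)
          (Complex.exp (((inner ℝ w (-ξ) : ℝ) : ℂ) * Complex.I) * g w) =
          Complex.exp (((inner ℝ w ξ : ℝ) : ℂ) * Complex.I) * (starRingEnd ℂ) (g w) := fun w => by
        simp [← Complex.exp_conj]
      simp only [e]
      rw [h1, ← integral_add (hbi _ hgi) (hbi _ hci), ← integral_const_mul]
      refine integral_congr_ae (ae_of_all _ fun w => ?_)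
      simp only [← mul_add, Complex.add_conj, Complex.real_smul, hq]
      push_cast
      ring
    linear_combination (1 / 2 : ℂ) * h2 + (1 / 2 : ℂ) * h3 + (1 / 2 : ℂ) * charFun ρ ξ * h4
  have hadd : ∀ (a b : Measure V) [IsFiniteMeasure a] [IsFiniteMeasure b] (ξ : V),
      charFun (a + b) ξ = charFun a ξ + charFun b ξ := by
    intro a b _ _ ξ
    refine integral_add_measure ?_ ?_ <;>
    exact (integrable_const (1 : ℝ)).mono' (by fun_prop) (ae_of_all _ (hexp ξ))
  -- The density `Re g` may change sign, so its negative part is moved to the other side; uniqueness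
  -- of characteristic functions then applies to finite positive measures.
  have hmeas : μ + m₂.conv ρ = m₁.conv ρ := by
    refine Measure.ext_of_charFun (funext fun ξ => ?_)
    rw [hadd, charFun_conv, charFun_conv, hdiff]
    ring
  have hui : ∀ (a : Measure V) [IsFiniteMeasure a], Integrable u a := fun a _ =>
    (integrable_const M).mono' hu.aestronglyMeasurable (ae_of_all _ hM)
  have h1 : ∫ x, u x ∂μ = ∫ x, u x ∂(m₁.conv ρ) - ∫ x, u x ∂(m₂.conv ρ) := by
    rw [← hmeas, integral_add_measure (hui _) (hui _)]
    ring
  rw [h1, integral_conv (hui _), integral_conv (hui _)]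
  refine integral_withDensity_sub_neg hqm hqi (M := M) ?_ ?_
  · exact (StronglyMeasurable.integral_prod_right
      (f := fun x y : V => u (x + y))
      (hu.comp measurable_add).stronglyMeasurable).aestronglyMeasurable
  · intro x
    have h := norm_integral_le_of_norm_le_const (μ := ρ) (f := fun y => u (x + y)) (C := M)
      (ae_of_all _ fun y => hM _)
    simpa using h

/-- Translating a bounded function changes its integral against a measure with an integrable
smooth factor by at most a multiple of the size of the translation. -/
lemma abs_integral_comp_add_sub_le {g : V → ℂ} {C : ℝ} (hg : ContDiff ℝ 1 g)
    (hgb : ∀ w, ‖g w‖ ≤ C * ((1 + ‖w‖) ^ (Module.finrank ℝ V + 1))⁻¹)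
    (hDg : ∀ w, ‖fderiv ℝ g w‖ ≤ C * ((1 + ‖w‖) ^ (Module.finrank ℝ V + 1))⁻¹)
    {μ ρ : Measure V} [IsProbabilityMeasure μ] [IsProbabilityMeasure ρ]
    (hchar : ∀ ξ, charFun μ ξ =
      (∫ w, Complex.exp (((inner ℝ w ξ : ℝ) : ℂ) * Complex.I) * g w) * charFun ρ ξ)
    {u : V → ℝ} (hu : Measurable u) {M : ℝ} (hM : ∀ x, |u x| ≤ M) {a : V} (ha : ‖a‖ ≤ 1) :
    |∫ x, u (a + x) ∂μ - ∫ x, u x ∂μ| ≤ C * 2 ^ (Module.finrank ℝ V + 1) *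
      (∫ y : V, ((1 + ‖y‖) ^ (Module.finrank ℝ V + 1))⁻¹) * ‖a‖ * M := by
  have hgi : Integrable g := (integrable_inv_one_add_norm_pow.const_mul C).mono'
    hg.continuous.aestronglyMeasurable (ae_of_all _ hgb)
  have hM0 : 0 ≤ M := (abs_nonneg _).trans (hM 0)
  set U : V → ℝ := fun x => ∫ y, u (x + y) ∂ρ with hU
  have hUm : StronglyMeasurable U := StronglyMeasurable.integral_prod_right
      (f := fun x y : V => u (x + y)) (hu.comp measurable_add).stronglyMeasurable
  have hUb : ∀ x, ‖U x‖ ≤ M := by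
    intro x
    have h := norm_integral_le_of_norm_le_const (μ := ρ) (f := fun y => u (x + y)) (C := M)
      (ae_of_all _ fun y => hM _)
    simpa using h
  -- Invariance of Lebesgue measure transfers the shift from `u`, which is merely bounded, to the
  -- smooth `g`.
  have e1 : ∫ x, u (a + x) ∂μ = ∫ x, (g (x - a)).re * U x := by
    rw [integral_eq_integral_re_mul hg.continuous.measurable hgi hchar
      (u := fun x => u (a + x)) (by fun_prop) fun x => hM _,
      ← integral_add_right_eq_self (fun x => (g (x - a)).re * U x) a]
    refine integral_congr_ae (ae_of_all _ fun x => ?_)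
    simp only [add_sub_cancel_left, hU, add_comm x a, add_assoc]
  have e2 : ∫ x, u x ∂μ = ∫ x, (g x).re * U x :=
    integral_eq_integral_re_mul hg.continuous.measurable hgi hchar hu hM
  have hgi' : Integrable fun x => g (x - a) := hgi.comp_sub_right a
  have hi : Integrable fun x => (g x).re * U x :=
    hgi.re.mul_bdd (c := M) hUm.aestronglyMeasurable (ae_of_all _ hUb)
  have hi' : Integrable fun x => (g (x - a)).re * U x :=
    hgi'.re.mul_bdd (c := M) hUm.aestronglyMeasurable (ae_of_all _ hUb)
  rw [e1, e2, ← integral_sub hi' hi, ← Real.norm_eq_abs]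
  calc _ ≤ ∫ x, ‖g (x - a) - g x‖ * M := by
        refine norm_integral_le_of_norm_le ((hgi'.sub hgi).norm.mul_const M)
          (ae_of_all _ fun x => ?_)
        rw [← sub_mul, ← Complex.sub_re, norm_mul, Real.norm_eq_abs]
        gcongr
        · exact Complex.abs_re_le_norm _
        · exact hUb x
    _ = (∫ x, ‖g (x - a) - g x‖) * M := integral_mul_const _ _
    _ ≤ _ := by
        gcongr
        exact integral_norm_comp_sub_sub_le hg hDg ha

end Translation

/-! ### Elementary inequalities for `1 - cos` -/

section Trig

lemma abs_sin_nat_mul_le (n : ℕ) (x : ℝ) : |Real.sin (n * x)| ≤ n * |Real.sin x| := by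
  induction n with
  | zero => simp
  | succ n ih =>
    rw [Nat.cast_succ, add_one_mul, Real.sin_add, add_one_mul]
    refine (abs_add_le _ _).trans ?_
    rw [abs_mul, abs_mul]
    exact add_le_add ((mul_le_of_le_one_right (abs_nonneg _) (Real.abs_cos_le_one x)).trans ih)
      (mul_le_of_le_one_left (abs_nonneg _) (Real.abs_cos_le_one _))

lemma one_sub_cos_eq (a : ℝ) : 1 - Real.cos a = 2 * Real.sin (a / 2) ^ 2 := by
  have h := Real.cos_sq' (a / 2)
  have h2 := Real.cos_two_mul (a / 2)
  rw [mul_div_cancel₀ a two_ne_zero] at h2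
  linarith

lemma one_sub_cos_nat_mul_le (n : ℕ) (a : ℝ) :
    1 - Real.cos (n * a) ≤ n ^ 2 * (1 - Real.cos a) := by
  rw [one_sub_cos_eq, one_sub_cos_eq, mul_div_assoc, ← sq_abs, ← sq_abs (Real.sin (a / 2))]
  have h := pow_le_pow_left₀ (abs_nonneg _) (abs_sin_nat_mul_le n (a / 2)) 2
  rw [mul_pow] at h
  linarith

lemma one_sub_cos_nonneg (a : ℝ) : 0 ≤ 1 - Real.cos a := by linarith [Real.cos_le_one a]

lemma one_sub_cos_le_two (a : ℝ) : 1 - Real.cos a ≤ 2 := by linarith [Real.neg_one_le_cos a]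

lemma one_sub_cos_re (a : ℝ) : (1 - Complex.exp (Complex.I * a)).re = 1 - Real.cos a := by
  rw [mul_comm, Complex.sub_re, Complex.one_re, Complex.exp_ofReal_mul_I_re]

end Trig

/-! ### Real part of the symbol and splitting of the jumps -/

section Symbol

variable {d : ℕ} {π : Measure (EuclideanSpace ℝ (Fin d))}

lemma IsLevyMeasure.integrable_min (hπ : IsLevyMeasure π) :
    Integrable (fun z => min 1 (‖z‖ ^ 2)) π := by
  refine ⟨by fun_prop, ?_⟩
  rw [hasFiniteIntegral_iff_ofReal (ae_of_all _ fun z => by positivity)]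
  exact hπ.lintegral_lt_top

lemma IsLevyMeasure.integral_min_nonneg : 0 ≤ ∫ z, min 1 (‖z‖ ^ 2) ∂π :=
  integral_nonneg fun z => by positivity

lemma norm_one_sub_exp_le_two (a : ℝ) : ‖1 - Complex.exp (Complex.I * a)‖ ≤ 2 := by
  refine (norm_sub_le _ _).trans ?_
  rw [mul_comm, Complex.norm_exp_ofReal_mul_I, norm_one]
  norm_num

lemma norm_levySymbol_integrand_le (ξ z : EuclideanSpace ℝ (Fin d)) :
    ‖1 - Complex.exp (Complex.I * ((inner ℝ ξ z : ℝ) : ℂ))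
      + (Metric.ball (0 : EuclideanSpace ℝ (Fin d)) 1).indicator
        (fun z => Complex.I * ((inner ℝ ξ z : ℝ) : ℂ)) z‖ ≤
      (2 + ‖ξ‖ ^ 2) * min 1 (‖z‖ ^ 2) := by
  by_cases hz : ‖z‖ < 1
  · rw [Set.indicator_of_mem (by simpa using hz), min_eq_right (pow_le_one₀ (norm_nonneg z) hz.le)]
    refine (norm_compensated_exp_le _).trans ?_
    rw [← sq_abs]
    calc _ ≤ (‖ξ‖ * ‖z‖) ^ 2 := by
          gcongr
          exact abs_real_inner_le_norm ξ z
      _ ≤ _ := by rw [mul_pow]; gcongr; linarith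
  · rw [Set.indicator_of_notMem (by simpa using hz), add_zero,
      min_eq_left (one_le_pow₀ (not_lt.1 hz)), mul_one]
    exact (norm_one_sub_exp_le_two _).trans (by linarith [sq_nonneg ‖ξ‖])

lemma IsLevyMeasure.integrable_symbol (hπ : IsLevyMeasure π) (ξ : EuclideanSpace ℝ (Fin d)) :
    Integrable (fun z => 1 - Complex.exp (Complex.I * ((inner ℝ ξ z : ℝ) : ℂ))
      + (Metric.ball (0 : EuclideanSpace ℝ (Fin d)) 1).indicator
        (fun z => Complex.I * ((inner ℝ ξ z : ℝ) : ℂ)) z) π := by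
  refine (hπ.integrable_min.const_mul (2 + ‖ξ‖ ^ 2)).mono' ?_
    (ae_of_all _ fun z => norm_levySymbol_integrand_le ξ z)
  refine Measurable.aestronglyMeasurable ?_
  exact (by fun_prop : Measurable fun z : EuclideanSpace ℝ (Fin d) =>
    1 - Complex.exp (Complex.I * ((inner ℝ ξ z : ℝ) : ℂ))).add
    ((by fun_prop : Measurable fun z : EuclideanSpace ℝ (Fin d) =>
      Complex.I * ((inner ℝ ξ z : ℝ) : ℂ)).indicator measurableSet_ball)

lemma re_levySymbol_integrand (ξ z : EuclideanSpace ℝ (Fin d)) :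
    (1 - Complex.exp (Complex.I * ((inner ℝ ξ z : ℝ) : ℂ))
      + (Metric.ball (0 : EuclideanSpace ℝ (Fin d)) 1).indicator
        (fun z => Complex.I * ((inner ℝ ξ z : ℝ) : ℂ)) z).re = 1 - Real.cos (inner ℝ ξ z) := by
  rw [Complex.add_re, one_sub_cos_re]
  by_cases hz : z ∈ Metric.ball (0 : EuclideanSpace ℝ (Fin d)) 1
  · rw [Set.indicator_of_mem hz]; simp
  · rw [Set.indicator_of_notMem hz]; simp

lemma IsLevyMeasure.integrable_one_sub_cos (hπ : IsLevyMeasure π)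
    (ξ : EuclideanSpace ℝ (Fin d)) : Integrable (fun z => 1 - Real.cos (inner ℝ ξ z)) π := by
  refine (hπ.integrable_symbol ξ).re.congr (ae_of_all _ fun z => ?_)
  exact re_levySymbol_integrand ξ z

lemma IsLevyMeasure.re_levySymbol (hπ : IsLevyMeasure π) (ξ : EuclideanSpace ℝ (Fin d)) :
    (levySymbol π ξ).re = ∫ z, (1 - Real.cos (inner ℝ ξ z)) ∂π := by
  have h := integral_re (hπ.integrable_symbol ξ)
  refine h.symm.trans (integral_congr_ae (ae_of_all _ fun z => ?_))
  exact re_levySymbol_integrand ξ z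

lemma IsLevyMeasure.re_levySymbol_nonneg (hπ : IsLevyMeasure π)
    (ξ : EuclideanSpace ℝ (Fin d)) : 0 ≤ (levySymbol π ξ).re := by
  rw [hπ.re_levySymbol]
  exact integral_nonneg fun z => one_sub_cos_nonneg _

lemma IsLevyMeasure.re_levySymbol_le (hπ : IsLevyMeasure π) (ξ : EuclideanSpace ℝ (Fin d)) :
    (levySymbol π ξ).re ≤ (2 + ‖ξ‖ ^ 2) * ∫ z, min 1 (‖z‖ ^ 2) ∂π := by
  rw [hπ.re_levySymbol, ← integral_const_mul]
  refine integral_mono (hπ.integrable_one_sub_cos ξ) (hπ.integrable_min.const_mul _) fun z => ?_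
  refine (le_trans ?_ (norm_levySymbol_integrand_le ξ z))
  rw [← re_levySymbol_integrand]
  exact Complex.re_le_norm _

/-- Integrates `1 - cos (n a) ≤ n² (1 - cos a)`. It carries upper bounds from the unit ball outwards
and lower bounds from high frequencies inwards. -/
lemma IsLevyMeasure.re_levySymbol_nat_smul_le (hπ : IsLevyMeasure π) (n : ℕ)
    (ξ : EuclideanSpace ℝ (Fin d)) :
    (levySymbol π ((n : ℝ) • ξ)).re ≤ n ^ 2 * (levySymbol π ξ).re := by
  rw [hπ.re_levySymbol, hπ.re_levySymbol, ← integral_const_mul]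
  refine integral_mono (hπ.integrable_one_sub_cos _) ((hπ.integrable_one_sub_cos ξ).const_mul _)
    fun z => ?_
  simpa only [inner_smul_left, RCLike.conj_to_real] using! one_sub_cos_nat_mul_le n (inner ℝ ξ z)

/-- The part of a Lévy measure describing the jumps of size less than one. -/
noncomputable def smallJumps (π : Measure (EuclideanSpace ℝ (Fin d))) :
    Measure (EuclideanSpace ℝ (Fin d)) := π.restrict (Metric.ball 0 1)

/-- The part of a Lévy measure describing the jumps of size at least one. -/
noncomputable def bigJumps (π : Measure (EuclideanSpace ℝ (Fin d))) :
    Measure (EuclideanSpace ℝ (Fin d)) := π.restrict (Metric.ball 0 1)ᶜ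

lemma ae_smallJumps : ∀ᵐ z ∂(smallJumps π), ‖z‖ < 1 := by
  filter_upwards [ae_restrict_mem measurableSet_ball] with z hz
  simpa using hz

lemma ae_bigJumps : ∀ᵐ z ∂(bigJumps π), 1 ≤ ‖z‖ := by
  filter_upwards [ae_restrict_mem measurableSet_ball.compl] with z hz
  simpa using hz

lemma IsLevyMeasure.integrable_sq_smallJumps (hπ : IsLevyMeasure π) :
    Integrable (fun z => ‖z‖ ^ 2) (smallJumps π) := by
  refine (hπ.integrable_min.mono_measure Measure.restrict_le_self).congr ?_
  filter_upwards [ae_smallJumps] with z hz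
  exact min_eq_right (pow_le_one₀ (norm_nonneg z) hz.le)

lemma IsLevyMeasure.isFiniteMeasure_bigJumps (hπ : IsLevyMeasure π) :
    IsFiniteMeasure (bigJumps π) := by
  have h : Integrable (fun _ => (1 : ℝ)) (bigJumps π) := by
    refine (hπ.integrable_min.mono_measure Measure.restrict_le_self).congr ?_
    filter_upwards [ae_bigJumps] with z hz
    exact min_eq_left (one_le_pow₀ hz)
  exact (integrable_const_iff.1 h).resolve_left one_ne_zero

/-- The symbol is the sum of a compensated symbol and of the symbol of a compound Poisson process.
-/
lemma IsLevyMeasure.levySymbol_eq (hπ : IsLevyMeasure π) (ξ : EuclideanSpace ℝ (Fin d)) :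
    levySymbol π ξ = compensatedSymbol (smallJumps π) ξ +
      ((bigJumps π).real Set.univ - charFun (bigJumps π) ξ) := by
  have := hπ.isFiniteMeasure_bigJumps
  rw [levySymbol, ← integral_add_compl measurableSet_ball (hπ.integrable_symbol ξ)]
  congr 1
  · refine setIntegral_congr_fun measurableSet_ball fun z hz => ?_
    simp only [Set.indicator_of_mem hz]
  · have h : ∫ z, (1 - Complex.exp (Complex.I * ((inner ℝ ξ z : ℝ) : ℂ))) ∂(bigJumps π) =
        (bigJumps π).real Set.univ - charFun (bigJumps π) ξ := by
      rw [integral_sub (integrable_const _) ?_, charFun_apply]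
      · simp [real_inner_comm, mul_comm]
      · exact (integrable_const (1 : ℝ)).mono' (by fun_prop) (ae_of_all _ fun z => by
          rw [mul_comm, Complex.norm_exp_ofReal_mul_I])
    rw [← h]
    refine setIntegral_congr_fun measurableSet_ball.compl fun z hz => ?_
    simp only [Set.indicator_of_notMem hz, add_zero]

/-- The factorisation behind the gradient bound: the first factor is the transform of a smooth
kernel, the second belongs to a probability measure. -/
lemma IsLevyMeasure.exp_neg_levySymbol (hπ : IsLevyMeasure π) (ξ : EuclideanSpace ℝ (Fin d)) :
    Complex.exp (-levySymbol π ξ) = Complex.exp (-compensatedSymbol (smallJumps π) ξ) *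
      charFun (compoundPoisson (bigJumps π)) ξ := by
  have := hπ.isFiniteMeasure_bigJumps
  rw [charFun_compoundPoisson, ← Complex.exp_add, hπ.levySymbol_eq]
  congr 1
  ring

/-- The large jumps contribute at most twice their mass to the real part, so decay of `e^{-Re Φ}`
passes to the small jumps with a constant factor. -/
lemma IsLevyMeasure.re_levySymbol_sub_le (hπ : IsLevyMeasure π) (ξ : EuclideanSpace ℝ (Fin d)) :
    (levySymbol π ξ).re - 2 * (bigJumps π).real Set.univ ≤
      (compensatedSymbol (smallJumps π) ξ).re := by
  have := hπ.isFiniteMeasure_bigJumps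
  have h : -(bigJumps π).real Set.univ ≤ (charFun (bigJumps π) ξ).re :=
    (neg_le_neg (norm_charFun_le ξ)).trans (neg_le_of_abs_le (Complex.abs_re_le_norm _))
  rw [hπ.levySymbol_eq]
  simp only [Complex.add_re, Complex.sub_re, Complex.ofReal_re]
  linarith

lemma inner_single_eq (i : Fin d) (s : ℝ) (z : EuclideanSpace ℝ (Fin d)) :
    inner ℝ (EuclideanSpace.single i s) z = s * z i := by
  simp [EuclideanSpace.inner_single_left]

/-- For `|a| ≤ π` one has `a² ≤ (π² / 2)(1 - cos a)`. Applied to each coordinate of a small jump,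
this reduces the second moment to the values of `Re Φ` at the `d` unit vectors. -/
lemma IsLevyMeasure.integral_sq_smallJumps_le (hπ : IsLevyMeasure π) {A : ℝ}
    (hA : ∀ ξ, ‖ξ‖ ≤ 1 → (levySymbol π ξ).re ≤ A) :
    ∫ z, ‖z‖ ^ 2 ∂(smallJumps π) ≤ d * (Real.pi ^ 2 / 2 * A) := by
  have hcos : ∀ i : Fin d,
      Integrable (fun z => 1 - Real.cos (inner ℝ (EuclideanSpace.single i (1 : ℝ)) z)) π :=
    fun i => hπ.integrable_one_sub_cos _
  calc _ ≤ ∫ z, ∑ i : Fin d, Real.pi ^ 2 / 2 *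
        (1 - Real.cos (inner ℝ (EuclideanSpace.single i (1 : ℝ)) z)) ∂(smallJumps π) := by
        refine integral_mono_ae hπ.integrable_sq_smallJumps (integrable_finsetSum _ fun i _ =>
          ((hcos i).mono_measure Measure.restrict_le_self).const_mul _) ?_
        filter_upwards [ae_smallJumps] with z hz
        rw [EuclideanSpace.norm_sq_eq]
        refine Finset.sum_le_sum fun i _ => ?_
        have hi : |z i| ≤ Real.pi :=
          (PiLp.norm_apply_le z i).trans (hz.le.trans (by linarith [Real.two_le_pi]))
        have h := Real.cos_le_one_sub_mul_cos_sq hi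
        rw [inner_single_eq, one_mul, Real.norm_eq_abs, sq_abs]
        have hpi := Real.pi_pos
        calc z i ^ 2 = Real.pi ^ 2 / 2 * (2 / Real.pi ^ 2 * z i ^ 2) := by field_simp
          _ ≤ _ := by gcongr; linarith
    _ = ∑ i : Fin d, Real.pi ^ 2 / 2 *
        ∫ z, (1 - Real.cos (inner ℝ (EuclideanSpace.single i (1 : ℝ)) z)) ∂(smallJumps π) := by
        rw [integral_finsetSum]
        · simp only [integral_const_mul]
        · exact fun i _ => ((hcos i).mono_measure Measure.restrict_le_self).const_mul _
    _ ≤ ∑ _i : Fin d, Real.pi ^ 2 / 2 * A := by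
        gcongr with i _
        refine le_trans ?_ (hA (EuclideanSpace.single i (1 : ℝ)) (by simp))
        rw [hπ.re_levySymbol]
        exact integral_mono_measure Measure.restrict_le_self
          (ae_of_all _ fun z => one_sub_cos_nonneg _) (hcos i)
    _ = _ := by simp

lemma le_intervalIntegral_one_sub_cos {S a : ℝ} (ha : a ≠ 0) :
    S - |a|⁻¹ ≤ ∫ s in (0 : ℝ)..S, (1 - Real.cos (s * a)) := by
  rw [intervalIntegral.integral_sub (by simp)
    (Continuous.intervalIntegrable (by fun_prop) _ _),
    intervalIntegral.integral_comp_mul_right _ ha]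
  simp only [intervalIntegral.integral_const, sub_zero, smul_eq_mul, mul_one, zero_mul,
    integral_cos, Real.sin_zero]
  gcongr
  refine (le_abs_self _).trans ?_
  rw [abs_mul, abs_inv]
  exact mul_le_of_le_one_right (by positivity) (Real.abs_sin_le_one _)

lemma exists_inv_card_le_abs {z : EuclideanSpace ℝ (Fin d)} (hd : 1 ≤ d) (hz : 1 ≤ ‖z‖) :
    ∃ i, (d : ℝ)⁻¹ ≤ |z i| := by
  by_contra! h
  have hd' : (1 : ℝ) ≤ d := by exact_mod_cast hd
  have h1 : (1 : ℝ) ≤ ∑ i, ‖z i‖ ^ 2 := by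
    rw [← EuclideanSpace.norm_sq_eq]
    exact one_le_pow₀ hz
  have h2 : ∑ i, ‖z i‖ ^ 2 < ∑ _i : Fin d, ((d : ℝ)⁻¹) ^ 2 := by
    have : Nonempty (Fin d) := ⟨⟨0, hd⟩⟩
    refine Finset.sum_lt_sum_of_nonempty Finset.univ_nonempty fun i _ => ?_
    gcongr
    exact h i
  have h3 : ∑ _i : Fin d, ((d : ℝ)⁻¹) ^ 2 = (d : ℝ)⁻¹ := by
    simp only [Finset.sum_const, Finset.card_univ, Fintype.card_fin, nsmul_eq_mul]
    field_simp
  have h4 : (d : ℝ)⁻¹ ≤ 1 := inv_le_one_of_one_le₀ hd'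
  linarith

/-- A single frequency can miss jumps where the cosine is 1, so frequencies `s eᵢ` are integrated
over `0 ≤ s ≤ S`. A jump of norm at least one has a coordinate of modulus at least `1 / d`, for
which the integral of `1 - cos` is at least `S - d`. Fubini then bounds the mass by integrals of `Re
Φ`. -/
lemma IsLevyMeasure.bigJumps_univ_le (hπ : IsLevyMeasure π) (hd : 1 ≤ d) {A : ℝ}
    (hA : ∀ ξ, ‖ξ‖ ≤ 1 → (levySymbol π ξ).re ≤ A) :
    (bigJumps π).real Set.univ ≤ 8 * d ^ 3 * A := by
  have := hπ.isFiniteMeasure_bigJumps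
  have hd' : (1 : ℝ) ≤ d := by exact_mod_cast hd
  -- This choice makes `S - d = d > 0`; being an integer, `2 * d` also brings the frequencies `s ≤
  -- S` back to the unit ball at the cost `(2d)²`.
  set S : ℝ := 2 * d with hS
  have hcont : ∀ i : Fin d, Continuous fun p : ℝ × EuclideanSpace ℝ (Fin d) =>
      1 - Real.cos (p.1 * p.2 i) := fun i => by fun_prop
  have : IsFiniteMeasure (volume.restrict (Set.uIoc 0 S)) := by
    rw [Set.uIoc_of_le (by positivity)]
    infer_instance
  have hint : ∀ i : Fin d, Integrable (Function.uncurry fun (s : ℝ)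
      (z : EuclideanSpace ℝ (Fin d)) => 1 - Real.cos (s * z i))
      ((volume.restrict (Set.uIoc 0 S)).prod (bigJumps π)) := fun i =>
    (integrable_const (2 : ℝ)).mono' (hcont i).aestronglyMeasurable (ae_of_all _ fun p => by
      rw [Function.uncurry, Real.norm_of_nonneg (one_sub_cos_nonneg _)]
      exact one_sub_cos_le_two _)
  have hlow : ∀ᵐ z ∂(bigJumps π),
      (d : ℝ) ≤ ∑ i : Fin d, ∫ s in (0 : ℝ)..S, (1 - Real.cos (s * z i)) := by
    filter_upwards [ae_bigJumps] with z hz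
    obtain ⟨i, hi⟩ := exists_inv_card_le_abs hd hz
    have hi0 : z i ≠ 0 := abs_pos.1 (lt_of_lt_of_le (by positivity) hi)
    calc (d : ℝ) = S - d := by rw [hS]; ring
      _ ≤ S - |z i|⁻¹ := by
          gcongr
          exact inv_le_of_inv_le₀ (by positivity) hi
      _ ≤ ∫ s in (0 : ℝ)..S, (1 - Real.cos (s * z i)) := le_intervalIntegral_one_sub_cos hi0
      _ ≤ _ := Finset.single_le_sum
          (f := fun i => ∫ s in (0 : ℝ)..S, (1 - Real.cos (s * z i)))
          (fun j _ => intervalIntegral.integral_nonneg (by positivity)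
            fun s _ => one_sub_cos_nonneg _) (Finset.mem_univ i)
  have hup : ∀ (i : Fin d), ∀ s ∈ Set.Icc (0 : ℝ) S,
      ∫ z, (1 - Real.cos (s * z i)) ∂(bigJumps π) ≤ 4 * d ^ 2 * A := by
    intro i s hs
    calc _ ≤ ∫ z, (1 - Real.cos (s * z i)) ∂π := by
          refine integral_mono_measure Measure.restrict_le_self
            (ae_of_all _ fun z => one_sub_cos_nonneg _) ?_
          simpa only [inner_single_eq] using
            hπ.integrable_one_sub_cos (EuclideanSpace.single i s)
      _ = (levySymbol π (EuclideanSpace.single i s)).re := by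
          simp only [hπ.re_levySymbol, inner_single_eq]
      _ = (levySymbol π (((2 * d : ℕ) : ℝ) • EuclideanSpace.single i (s / S))).re := by
          congr 2
          ext j
          have hS0 : S ≠ 0 := by positivity
          have : ((2 * d : ℕ) : ℝ) * (s / S) = s := by
            rw [Nat.cast_mul, Nat.cast_ofNat, ← hS, mul_div_cancel₀ s hS0]
          by_cases hj : j = i
          · subst hj
            simpa using this.symm
          · simp [hj]
      _ ≤ ((2 * d : ℕ) : ℝ) ^ 2 * (levySymbol π (EuclideanSpace.single i (s / S))).re :=
          hπ.re_levySymbol_nat_smul_le _ _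
      _ ≤ ((2 * d : ℕ) : ℝ) ^ 2 * A := by
          gcongr
          refine hA _ ?_
          rw [PiLp.norm_single, Real.norm_of_nonneg (by have := hs.1; positivity)]
          exact div_le_one_of_le₀ hs.2 (by positivity)
      _ = _ := by push_cast; ring
  have hkey : (d : ℝ) * (bigJumps π).real Set.univ ≤ d * (S * (4 * d ^ 2 * A)) := by
    calc (d : ℝ) * (bigJumps π).real Set.univ = ∫ _z, (d : ℝ) ∂(bigJumps π) := by
          simp [mul_comm]
      _ ≤ ∫ z, (∑ i : Fin d, ∫ s in (0 : ℝ)..S, (1 - Real.cos (s * z i))) ∂(bigJumps π) := by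
          refine integral_mono_ae (integrable_const _) (integrable_finsetSum _ fun i _ => ?_) hlow
          have h := (hint i).integral_prod_right
          refine h.congr (ae_of_all _ fun z => ?_)
          simp only [Function.uncurry]
          rw [intervalIntegral.integral_of_le (by positivity), Set.uIoc_of_le (by positivity)]
      _ = ∑ i : Fin d, ∫ s in (0 : ℝ)..S, (∫ z, (1 - Real.cos (s * z i)) ∂(bigJumps π)) := by
          rw [integral_finsetSum]
          · refine Finset.sum_congr rfl fun i _ => ?_
            exact (intervalIntegral_integral_swap (hint i)).symm
          · intro i _
            have h := (hint i).integral_prod_right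
            refine h.congr (ae_of_all _ fun z => ?_)
            simp only [Function.uncurry]
            rw [intervalIntegral.integral_of_le (by positivity), Set.uIoc_of_le (by positivity)]
      _ ≤ ∑ _i : Fin d, S * (4 * d ^ 2 * A) := by
          refine Finset.sum_le_sum fun i _ => ?_
          have h := intervalIntegral.integral_mono_on (a := (0 : ℝ)) (b := S) (by positivity)
            ?_ (by simp : IntervalIntegrable (fun _ => 4 * d ^ 2 * A) volume 0 S) (hup i)
          · simpa only [intervalIntegral.integral_const, sub_zero, smul_eq_mul] using h
          · rw [intervalIntegrable_iff]
            exact (hint i).integral_prod_left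
      _ = _ := by simp
  have := le_of_mul_le_mul_left hkey (by positivity)
  refine this.trans_eq ?_
  rw [hS]
  ring

end Symbol

/-! ### Uniform translation bounds and scaling of the Lévy measure -/

section Scaling

variable {d : ℕ}

/-- Lipschitz bound for small translations, uniform over all infinitely divisible distributions
whose symbol is bounded by `A` on the unit ball and whose characteristic function decays fast. -/
lemma exists_abs_integral_comp_add_sub_le (hd : 1 ≤ d) (A K : ℝ) :
    ∃ C, 0 < C ∧ ∀ π : Measure (EuclideanSpace ℝ (Fin d)), IsLevyMeasure π →
      (∀ ξ, ‖ξ‖ ≤ 1 → (levySymbol π ξ).re ≤ A) →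
      (∀ ξ, Real.exp (-(levySymbol π ξ).re) * (1 + ‖ξ‖) ^ (2 * d + 3) ≤ K) →
      ∀ (μ : Measure (EuclideanSpace ℝ (Fin d))) [IsProbabilityMeasure μ]
        (b : EuclideanSpace ℝ (Fin d)),
      (∀ ξ, charFun μ ((2 * Real.pi) • ξ) =
        Complex.exp (-levySymbol π ξ) * Complex.exp (inner ℝ b ξ * Complex.I)) →
      ∀ u : EuclideanSpace ℝ (Fin d) → ℝ, Measurable u → ∀ M : ℝ, (∀ x, |u x| ≤ M) →
      ∀ a, ‖a‖ ≤ 1 → |∫ x, u (a + x) ∂μ - ∫ x, u x ∂μ| ≤ C * ‖a‖ * M := by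
  obtain ⟨C, hC⟩ := exists_kernel (V := EuclideanSpace ℝ (Fin d)) (d * (Real.pi ^ 2 / 2 * A))
    (Real.exp (2 * (8 * d ^ 3 * A)) * K)
  simp only [finrank_euclideanSpace_fin] at hC
  set B : ℝ := C * 2 ^ (d + 1) * ∫ y : EuclideanSpace ℝ (Fin d), ((1 + ‖y‖) ^ (d + 1))⁻¹ with hB
  refine ⟨|B| + 1, by positivity, fun π hπ hA hK μ _ b hμ u hu M hM a ha => ?_⟩
  have hM0 : 0 ≤ M := (abs_nonneg _).trans (hM 0)
  obtain ⟨g, hg, hgb, hDg, hgF⟩ := hC (smallJumps π) hπ.integrable_sq_smallJumps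
    (ae_smallJumps.mono fun z hz => hz.le) (hπ.integral_sq_smallJumps_le hA) fun ξ => by
      calc _ ≤ Real.exp (2 * (8 * d ^ 3 * A) + -(levySymbol π ξ).re) *
            (1 + ‖ξ‖) ^ (2 * d + 3) := by
            gcongr
            linarith [hπ.re_levySymbol_sub_le ξ, hπ.bigJumps_univ_le hd hA]
        _ = Real.exp (2 * (8 * d ^ 3 * A)) * (Real.exp (-(levySymbol π ξ).re) *
            (1 + ‖ξ‖) ^ (2 * d + 3)) := by rw [Real.exp_add, mul_assoc]
        _ ≤ _ := by gcongr; exact hK ξ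
  have := hπ.isFiniteMeasure_bigJumps
  have : IsProbabilityMeasure ((compoundPoisson (bigJumps π)).map (· + b)) :=
    Measure.isProbabilityMeasure_map (by fun_prop)
  have : IsProbabilityMeasure
      (((compoundPoisson (bigJumps π)).map (· + b)).map ((2 * Real.pi)⁻¹ • ·)) :=
    Measure.isProbabilityMeasure_map (by fun_prop)
  have hpi := Real.pi_pos
  -- Here `ρ` is the compound Poisson law shifted by the drift `b`. Dividing by `2π` reconciles
  -- characteristic functions with the Fourier transform that defines `g`.
  have key := abs_integral_comp_add_sub_le (μ := μ)
    (ρ := ((compoundPoisson (bigJumps π)).map (· + b)).map ((2 * Real.pi)⁻¹ • ·)) (C := C) hg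
    (by simpa using hgb) (by simpa using hDg) ?_ hu hM ha
  · simp only [finrank_euclideanSpace_fin] at key
    refine key.trans ?_
    rw [← hB]
    gcongr
    linarith [le_abs_self B]
  · intro ξ
    obtain ⟨η, rfl⟩ : ∃ η, (2 * Real.pi) • η = ξ :=
      ⟨(2 * Real.pi)⁻¹ • ξ, smul_inv_smul₀ (by positivity) ξ⟩
    rw [hμ, charFun_map_smul, inv_smul_smul₀ (by positivity), charFun_map_add_const,
      hπ.exp_neg_levySymbol, ← hgF]
    simp only [inner_smul_right]
    ring

/-- The Lévy measure of `R • X t`, where `X` has Lévy measure `ν`. -/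
noncomputable def scaledLevy (ν : Measure (EuclideanSpace ℝ (Fin d))) (t : ℝ≥0) (R : ℝ) :
    Measure (EuclideanSpace ℝ (Fin d)) := (t • ν).map (R • ·)

variable {ν : Measure (EuclideanSpace ℝ (Fin d))}

lemma IsLevyMeasure.isLevyMeasure_scaledLevy (hν : IsLevyMeasure ν) (t : ℝ≥0) {R : ℝ} (hR : 0 < R) :
    IsLevyMeasure (scaledLevy ν t R) := by
  constructor
  · rw [scaledLevy, Measure.map_apply (by fun_prop) (measurableSet_singleton 0)]
    have : (R • · : EuclideanSpace ℝ (Fin d) → _) ⁻¹' {0} = {0} := by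
      ext z
      simp [hR.ne']
    simp [this, hν.zero_singleton]
  · rw [scaledLevy, lintegral_map (by fun_prop) (by fun_prop), lintegral_smul_measure]
    refine ENNReal.mul_lt_top (by simp) ?_
    calc _ ≤ ∫⁻ z, ENNReal.ofReal (1 + R ^ 2) * ENNReal.ofReal (min 1 (‖z‖ ^ 2)) ∂ν := by
          refine lintegral_mono fun z => ?_
          rw [← ENNReal.ofReal_mul (by positivity)]
          refine ENNReal.ofReal_le_ofReal ?_
          rw [norm_smul, mul_pow, Real.norm_of_nonneg hR.le]
          rcases le_total 1 (‖z‖ ^ 2) with h | h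
          · rw [min_eq_left h]
            exact (min_le_left _ _).trans (by nlinarith)
          · rw [min_eq_right h]
            refine (min_le_right _ _).trans ?_
            gcongr
            linarith
      _ = ENNReal.ofReal (1 + R ^ 2) * ∫⁻ z, ENNReal.ofReal (min 1 (‖z‖ ^ 2)) ∂ν :=
          lintegral_const_mul _ (by fun_prop)
      _ < ∞ := ENNReal.mul_lt_top ENNReal.ofReal_lt_top hν.lintegral_lt_top

/-- The difference of the truncation functions of `ν` and of `scaledLevy ν t R`. -/
noncomputable def truncationDiff (R : ℝ) (z : EuclideanSpace ℝ (Fin d)) : ℝ :=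
  (Metric.ball 0 1).indicator 1 z - (Metric.ball 0 1).indicator 1 (R • z)

lemma measurable_truncationDiff (R : ℝ) :
    Measurable (truncationDiff R : EuclideanSpace ℝ (Fin d) → ℝ) := by
  have h : Measurable ((Metric.ball (0 : EuclideanSpace ℝ (Fin d)) 1).indicator
      (1 : EuclideanSpace ℝ (Fin d) → ℝ)) :=
    measurable_one.indicator measurableSet_ball
  exact h.sub (h.comp (measurable_const_smul R))

/-- The two truncations differ only for `‖z‖` between `min 1 R⁻¹` and `max 1 R⁻¹`, where `‖z‖` is at
most a multiple of `1 ∧ ‖z‖²`. -/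
lemma IsLevyMeasure.integrable_truncationDiff_smul (hν : IsLevyMeasure ν) {R : ℝ} (hR : 0 < R) :
    Integrable (fun z => truncationDiff R z • z) ν := by
  set D : ℝ := max 1 R⁻¹ with hD
  set m : ℝ := min 1 R⁻¹ with hm
  have hm0 : 0 < m := by positivity
  refine (hν.integrable_min.const_mul (D / m ^ 2)).mono'
    ((measurable_truncationDiff R).smul measurable_id).aestronglyMeasurable
    (ae_of_all _ fun z => ?_)
  have hRz : ‖R • z‖ = R * ‖z‖ := by rw [norm_smul, Real.norm_of_nonneg hR.le]
  have key : m ≤ ‖z‖ → ‖z‖ ≤ D → ‖z‖ ≤ D / m ^ 2 * min 1 (‖z‖ ^ 2) := by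
    intro h1 h2
    have h3 : m ^ 2 ≤ min 1 (‖z‖ ^ 2) :=
      le_min (pow_le_one₀ hm0.le (min_le_left _ _)) (by gcongr)
    calc ‖z‖ ≤ D := h2
      _ = D / m ^ 2 * m ^ 2 := by field_simp
      _ ≤ _ := by gcongr
  rw [norm_smul]
  by_cases h1 : ‖z‖ < 1 <;> by_cases h2 : R * ‖z‖ < 1
  · have : truncationDiff R z = 0 := by
      simp [truncationDiff, Set.indicator, h1, hRz, h2]
    rw [this, norm_zero, zero_mul]
    positivity
  · have : truncationDiff R z = 1 := by
      simp [truncationDiff, Set.indicator, h1, hRz, h2]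
    rw [this, norm_one, one_mul]
    refine key ((min_le_right _ _).trans ?_) (h1.le.trans (le_max_left _ _))
    rw [inv_eq_one_div, div_le_iff₀' hR]
    exact not_lt.1 h2
  · have : truncationDiff R z = -1 := by
      simp [truncationDiff, Set.indicator, h1, hRz, h2]
    rw [this, norm_neg, norm_one, one_mul]
    refine key ((min_le_left _ _).trans (not_lt.1 h1)) (le_trans ?_ (le_max_right _ _))
    rw [inv_eq_one_div, le_div_iff₀' hR]
    exact h2.le
  · have : truncationDiff R z = 0 := by
      simp [truncationDiff, Set.indicator, h1, hRz, h2]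
    rw [this, norm_zero, zero_mul]
    positivity

/-- Scaling also moves the truncation ball. The resulting correction is linear in `ξ`, hence a
deterministic drift `b`, which does not affect the gradient bound. -/
lemma IsLevyMeasure.exists_levySymbol_scaledLevy (hν : IsLevyMeasure ν) (t : ℝ≥0) {R : ℝ}
    (hR : 0 < R) : ∃ b : EuclideanSpace ℝ (Fin d), ∀ ξ,
      (t : ℂ) * levySymbol ν (R • ξ) = levySymbol (scaledLevy ν t R) ξ -
        (inner ℝ b ξ : ℝ) * Complex.I := by
  refine ⟨-((t * R : ℝ) • ∫ z, truncationDiff R z • z ∂ν), fun ξ => ?_⟩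
  have hmeas : Measurable fun z : EuclideanSpace ℝ (Fin d) =>
      1 - Complex.exp (Complex.I * ((inner ℝ ξ z : ℝ) : ℂ))
      + (Metric.ball (0 : EuclideanSpace ℝ (Fin d)) 1).indicator
        (fun z => Complex.I * ((inner ℝ ξ z : ℝ) : ℂ)) z :=
    (by fun_prop : Measurable fun z : EuclideanSpace ℝ (Fin d) =>
      1 - Complex.exp (Complex.I * ((inner ℝ ξ z : ℝ) : ℂ))).add
      ((by fun_prop : Measurable fun z : EuclideanSpace ℝ (Fin d) =>
        Complex.I * ((inner ℝ ξ z : ℝ) : ℂ)).indicator measurableSet_ball)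
  have h1 : levySymbol (scaledLevy ν t R) ξ = (t : ℂ) *
      ∫ z, (1 - Complex.exp (Complex.I * ((inner ℝ ξ (R • z) : ℝ) : ℂ))
      + (Metric.ball (0 : EuclideanSpace ℝ (Fin d)) 1).indicator
        (fun z => Complex.I * ((inner ℝ ξ z : ℝ) : ℂ)) (R • z)) ∂ν := by
    rw [levySymbol, scaledLevy, integral_map (by fun_prop) hmeas.aestronglyMeasurable,
      integral_smul_nnreal_measure]
    simp [NNReal.smul_def]
  have h2 : inner ℝ ξ (∫ z, truncationDiff R z • z ∂ν) =
      ∫ z, inner ℝ ξ (truncationDiff R z • z) ∂ν :=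
    (integral_inner (hν.integrable_truncationDiff_smul hR) ξ).symm
  have hi : Integrable (fun z => Complex.I * (R * (inner ℝ ξ (truncationDiff R z • z) : ℝ) : ℂ))
      ν := by
    have := (hν.integrable_truncationDiff_smul hR).const_inner (𝕜 := ℝ) ξ
    exact (this.ofReal.const_mul _).const_mul _
  have h3 : levySymbol ν (R • ξ) -
      Complex.I * (R * (inner ℝ ξ (∫ z, truncationDiff R z • z ∂ν) : ℝ))
      = ∫ z, (1 - Complex.exp (Complex.I * ((inner ℝ ξ (R • z) : ℝ) : ℂ))
      + (Metric.ball (0 : EuclideanSpace ℝ (Fin d)) 1).indicator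
        (fun z => Complex.I * ((inner ℝ ξ z : ℝ) : ℂ)) (R • z)) ∂ν := by
    rw [h2, ← integral_complex_ofReal, ← integral_const_mul, ← integral_const_mul, levySymbol,
      ← integral_sub (hν.integrable_symbol _) hi]
    refine integral_congr_ae (ae_of_all _ fun z => ?_)
    simp only [truncationDiff, Set.indicator, inner_smul_left, inner_smul_right, Pi.one_apply,
      RCLike.conj_to_real]
    split_ifs <;> push_cast <;> ring
  rw [h1, ← h3, inner_neg_left, inner_smul_left, real_inner_comm]
  simp only [RCLike.conj_to_real]
  push_cast
  ring

end Scaling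

/-! ### The gradient estimate at a given scale -/

section Gradient

variable {d : ℕ}

lemma IsBoundedBorel.supNorm_lt_top {u : EuclideanSpace ℝ (Fin d) → ℝ} (hu : IsBoundedBorel u) :
    supNorm u < ∞ := by
  obtain ⟨M, hM⟩ := hu.2
  exact (iSup_le fun x => ENNReal.ofReal_le_ofReal (hM x)).trans_lt ENNReal.ofReal_lt_top

lemma IsBoundedBorel.abs_le {u : EuclideanSpace ℝ (Fin d) → ℝ} (hu : IsBoundedBorel u)
    (x : EuclideanSpace ℝ (Fin d)) : |u x| ≤ (supNorm u).toReal :=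
  (ENNReal.ofReal_le_iff_le_toReal hu.supNorm_lt_top.ne).1
    (le_iSup (fun x => ENNReal.ofReal |u x|) x)

lemma gradSupNorm_le_of_eventually {v : EuclideanSpace ℝ (Fin d) → ℝ} {L : ℝ}
    (h : ∀ x, ∀ᶠ y in 𝓝[≠] x, |v y - v x| ≤ L * ‖y - x‖) : gradSupNorm v ≤ ENNReal.ofReal L := by
  refine iSup_le fun x => limsup_le_of_le (by isBoundedDefault) ?_
  filter_upwards [h x, self_mem_nhdsWithin] with y hy hne
  refine ENNReal.ofReal_le_ofReal ?_
  rw [div_le_iff₀ (norm_pos_iff.2 (sub_ne_zero.2 hne))]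
  exact hy

/-- Gradient estimate for the semigroup at time `t`, at a scale `R` on which the symbol is
controlled. -/
lemma exists_gradSupNorm_levySemigroup_le (hd : 1 ≤ d) {Ω : Type*} [MeasurableSpace Ω]
    (P : Measure Ω) [IsProbabilityMeasure P] {ν : Measure (EuclideanSpace ℝ (Fin d))}
    (hν : IsLevyMeasure ν) {X : ℝ≥0 → Ω → EuclideanSpace ℝ (Fin d)} (hX : ∀ t, Measurable (X t))
    (hΦ : HasSymbol P X (levySymbol ν)) (A K : ℝ) :
    ∃ C, 0 < C ∧ ∀ (t : ℝ≥0) (R : ℝ), 0 < R →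
      (∀ ξ, ‖ξ‖ ≤ 1 → t * (levySymbol ν (R • ξ)).re ≤ A) →
      (∀ ξ, Real.exp (-(t * (levySymbol ν (R • ξ)).re)) * (1 + ‖ξ‖) ^ (2 * d + 3) ≤ K) →
      ∀ u : EuclideanSpace ℝ (Fin d) → ℝ, IsBoundedBorel u →
        gradSupNorm (levySemigroup P X t u) ≤
          ENNReal.ofReal C * supNorm u * ENNReal.ofReal R := by
  obtain ⟨C, hC0, hC⟩ := exists_abs_integral_comp_add_sub_le hd A K
  refine ⟨C, hC0, fun t R hR hA hK u hu => ?_⟩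
  obtain ⟨b, hb⟩ := hν.exists_levySymbol_scaledLevy t hR
  have hre : ∀ ξ, (levySymbol (scaledLevy ν t R) ξ).re = t * (levySymbol ν (R • ξ)).re := by
    intro ξ
    have h := congrArg Complex.re (hb ξ)
    have e : ((t : ℂ) * levySymbol ν (R • ξ)).re = t * (levySymbol ν (R • ξ)).re :=
      Complex.re_ofReal_mul t _
    rw [e] at h
    simpa using h.symm
  have hpi := Real.pi_pos
  -- Scaling by `R / 2π` rather than `R` makes the characteristic function at `2π ξ` that of `X t`
  -- at `R ξ`.
  set s : ℝ := R / (2 * Real.pi) with hs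
  have hs0 : 0 < s := by positivity
  set M : ℝ := (supNorm u).toReal with hM
  have hM0 : 0 ≤ M := ENNReal.toReal_nonneg
  have hsX : Measurable fun ω => s • X t ω := (hX t).const_smul s
  have : IsProbabilityMeasure (P.map fun ω => s • X t ω) :=
    Measure.isProbabilityMeasure_map hsX.aemeasurable
  have hchar : ∀ ξ, charFun (P.map fun ω => s • X t ω) ((2 * Real.pi) • ξ) =
      Complex.exp (-levySymbol (scaledLevy ν t R) ξ) *
        Complex.exp (inner ℝ b ξ * Complex.I) := by
    intro ξ
    have e : P.map (fun ω => s • X t ω) = (P.map (X t)).map (s • ·) :=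
      (Measure.map_map (measurable_const_smul s) (hX t)).symm
    have hsp : s * (2 * Real.pi) = R := by rw [hs]; field_simp
    rw [e, charFun_map_smul, smul_smul, hsp, hΦ, ← Complex.exp_add]
    congr 1
    have h : ((t : ℝ) : ℂ) * levySymbol ν (R • ξ) = _ := hb ξ
    linear_combination -h
  have hmain : ENNReal.ofReal C * supNorm u * ENNReal.ofReal R = ENNReal.ofReal (C * M * R) := by
    rw [ENNReal.ofReal_mul (by positivity), ENNReal.ofReal_mul hC0.le,
      ENNReal.ofReal_toReal hu.supNorm_lt_top.ne]
  rw [hmain]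
  refine gradSupNorm_le_of_eventually fun x => ?_
  have hnear : ∀ᶠ y in 𝓝[≠] x, ‖s • (y - x)‖ ≤ 1 := by
    have hc : Tendsto (fun y => ‖s • (y - x)‖) (𝓝[≠] x) (𝓝 0) := by
      have : Continuous fun y => ‖s • (y - x)‖ := by fun_prop
      simpa using (this.tendsto x).mono_left nhdsWithin_le_nhds
    exact (hc.eventually (gt_mem_nhds one_pos)).mono fun y hy => hy.le
  filter_upwards [hnear] with y hy
  have hum : Measurable fun w => u (x + s⁻¹ • w) := hu.1.comp (by fun_prop)
  -- The increment of `P_t u` from `x` to `y` is the effect of the shift `s (y - x)` on the rescaled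
  -- function `w ↦ u (x + w / s)` under the law of `s X_t`.
  have key := hC (scaledLevy ν t R) (hν.isLevyMeasure_scaledLevy t hR)
    (fun ξ hξ => (hre ξ).trans_le (hA ξ hξ))
    (fun ξ => by rw [hre]; exact hK ξ) _ b hchar (fun w => u (x + s⁻¹ • w)) hum M
    (fun w => hu.abs_le _) (s • (y - x)) hy
  have hum' : Measurable fun w => u (x + s⁻¹ • (s • (y - x) + w)) := hu.1.comp (by fun_prop)
  rw [integral_map hsX.aemeasurable hum'.aestronglyMeasurable,
    integral_map hsX.aemeasurable hum.aestronglyMeasurable] at key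
  simp only [smul_add, inv_smul_smul₀ hs0.ne', ← add_assoc, add_sub_cancel] at key
  refine key.trans ?_
  rw [norm_smul, Real.norm_of_nonneg hs0.le]
  have hsR : s ≤ R := div_le_self hR.le (by linarith [Real.two_le_pi])
  calc C * (s * ‖y - x‖) * M ≤ C * (R * ‖y - x‖) * M := by gcongr
    _ = _ := by ring

end Gradient

/-! ### Growth of functions with a doubling inverse -/

section Doubling

/-- Iterates doubling along `R, C R, C² R, …`. The bound allows `C * r₁` because the last doubling
is applied at `C ^ (k - 1) * R`, which only has to be at most `r₁`. -/
lemma two_pow_mul_le_of_doubling {f : ℝ → ℝ} {C R r₁ : ℝ} (hC : 1 < C) (hR : 0 < R)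
    (hf : ∀ r, R ≤ r → r ≤ r₁ → 2 * f r ≤ f (C * r)) (k : ℕ) (hk : C ^ k * R ≤ C * r₁) :
    2 ^ k * f R ≤ f (C ^ k * R) := by
  induction k with
  | zero => simp
  | succ k ih =>
    have h1 : C ^ k * R ≤ r₁ := by
      rw [pow_succ', mul_assoc] at hk
      exact le_of_mul_le_mul_left hk (by linarith)
    have hr₁ : 0 < r₁ := lt_of_lt_of_le (by positivity) h1
    have h2 : R ≤ C ^ k * R := le_mul_of_one_le_left hR.le (one_le_pow₀ hC.le)
    have h3 := hf _ h2 h1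
    have h4 := ih (h1.trans (le_mul_of_one_le_left hr₁.le hC.le))
    rw [pow_succ', pow_succ', mul_assoc C]
    linarith

/-- A function which doubles when its argument is multiplied by `C` grows so fast that the
exponential of its negative beats every power. -/
lemma exists_exp_neg_mul_pow_le_of_doubling {C c : ℝ} (hC : 1 < C) (hc : 0 < c) (m : ℕ) :
    ∃ K, ∀ (f : ℝ → ℝ) (R r : ℝ), MonotoneOn f (Set.Ici 0) → 0 < R → 0 < f R → R ≤ r →
      (∀ r', R ≤ r' → r' ≤ r → 2 * f r' ≤ f (C * r')) →
      Real.exp (-(c * (f r / f R))) * (r / R) ^ m ≤ K := by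
  -- If `C ^ k ≤ r / R < C ^ (k + 1)`, then the power is at most `C ^ m * (2 ^ k) ^ N` and the
  -- exponent at least `c * 2 ^ k`, so `x ^ N / N! ≤ e ^ x` finishes with a constant independent of
  -- `k`.
  obtain ⟨N, hN⟩ := pow_unbounded_of_one_lt (C ^ m) (one_lt_two : (1 : ℝ) < 2)
  refine ⟨C ^ m * (N.factorial / c ^ N), fun f R r hmono hR hfR hRr hf => ?_⟩
  obtain ⟨k, hk1, hk2⟩ := exists_nat_pow_near ((one_le_div hR).2 hRr) hC
  rw [le_div_iff₀ hR] at hk1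
  have hr : 0 < r := hR.trans_le hRr
  have hpow : 2 ^ k * f R ≤ f r := by
    refine (two_pow_mul_le_of_doubling hC hR hf k
      (hk1.trans (le_mul_of_one_le_left hr.le hC.le))).trans ?_
    exact hmono (Set.mem_Ici.2 (by positivity)) (Set.mem_Ici.2 hr.le) hk1
  have h2 : (2 : ℝ) ^ k ≤ f r / f R := (le_div_iff₀ hfR).2 hpow
  have h3 := Real.pow_div_factorial_le_exp (x := c * 2 ^ k) (by positivity) N
  have h4 : Real.exp (-(c * 2 ^ k)) * (2 ^ k) ^ N ≤ N.factorial / c ^ N := by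
    rw [Real.exp_neg, inv_mul_le_iff₀ (Real.exp_pos _), mul_div_assoc', le_div_iff₀ (by positivity)]
    rw [div_le_iff₀ (by positivity), mul_pow] at h3
    linarith
  have h5 : (r / R) ^ m ≤ C ^ m * (2 ^ k) ^ N := by
    calc (r / R) ^ m ≤ (C ^ (k + 1)) ^ m := by gcongr
      _ = C ^ m * (C ^ m) ^ k := by rw [← pow_mul, ← pow_mul, ← pow_add]; ring_nf
      _ ≤ C ^ m * (2 ^ N) ^ k := by gcongr
      _ = _ := by rw [← pow_mul, ← pow_mul, mul_comm N]
  calc _ ≤ Real.exp (-(c * 2 ^ k)) * (C ^ m * (2 ^ k) ^ N) := by gcongr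
    _ = C ^ m * (Real.exp (-(c * 2 ^ k)) * (2 ^ k) ^ N) := by ring
    _ ≤ _ := by gcongr

lemma rayInv_apply {f : ℝ → ℝ} (hf : StrictMonoOn f (Set.Ici 0)) {r : ℝ} (hr : 0 ≤ r) :
    rayInv f (f r) = r :=
  hf.injOn.leftInvOn_invFunOn hr

lemma exists_forall_lt_of_limsup_lt_top {l : Filter ℝ} {g : ℝ → ℝ}
    (h : limsup (fun s => ((g s : ℝ) : EReal)) l < ⊤) : ∃ C, 1 < C ∧ ∀ᶠ s in l, g s < C := by
  obtain ⟨C, hC, -⟩ := EReal.lt_iff_exists_real_btwn.1 h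
  refine ⟨max C 2, by simp, ?_⟩
  filter_upwards [eventually_lt_of_limsup_lt hC] with s hs
  exact (EReal.coe_lt_coe_iff.1 hs).trans_le (le_max_left _ _)

end Doubling

/-! ### Consequences of the growth conditions on the symbol -/

section Asymptotics

variable {d : ℕ} {Φ : EuclideanSpace ℝ (Fin d) → ℂ}

lemma HartmanWintner.exists_log_le (h : HartmanWintner Φ) (M : ℝ) :
    ∃ r, 0 < r ∧ ∀ ξ, r ≤ ‖ξ‖ → M * Real.log (1 + ‖ξ‖) ≤ (Φ ξ).re := by
  have h1 : (M : EReal) < liminf (fun ξ => (((Φ ξ).re / Real.log (1 + ‖ξ‖) : ℝ) : EReal))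
      (Bornology.cobounded (EuclideanSpace ℝ (Fin d))) := by
    rw [h]
    exact EReal.coe_lt_top M
  obtain ⟨r, -, hr⟩ := (hasBasis_cobounded_norm.eventually_iff).1 (eventually_lt_of_lt_liminf h1)
  refine ⟨max r 1, by positivity, fun ξ hξ => ?_⟩
  have h2 := EReal.coe_lt_coe_iff.1 (hr ((le_max_left _ _).trans hξ))
  have h3 : 0 < Real.log (1 + ‖ξ‖) :=
    Real.log_pos (by linarith [(le_max_right r 1).trans hξ])
  exact ((lt_div_iff₀ h3).1 h2).le

lemma exists_norm_eq_of_one_le (hd : 1 ≤ d) {r : ℝ} (hr : 0 ≤ r) :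
    ∃ ξ : EuclideanSpace ℝ (Fin d), ‖ξ‖ = r :=
  ⟨EuclideanSpace.single ⟨0, hd⟩ r, by simp [abs_of_nonneg hr]⟩

/-- At `s = f r` the bound `f⁻¹(2s) < C f⁻¹(s)` becomes `2 f r ≤ f (C r)`, provided `2 f r` is a
value of `f`. It is one far out: `f` tends to infinity by comparison with the logarithm, and
differentiability gives continuity for the intermediate value theorem. -/
lemma ControlsAtInfinity.exists_doubling (hd : 1 ≤ d) {f : ℝ → ℝ} (hf : ControlsAtInfinity Φ f)
    (hHW : HartmanWintner Φ) (b : ℝ) :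
    ∃ C r₁, 1 < C ∧ b ≤ r₁ ∧ 0 < r₁ ∧ 0 < f r₁ ∧ (∀ r, r₁ ≤ r → 2 * f r ≤ f (C * r)) ∧
      ∀ s, f r₁ ≤ s → ∃ r, r₁ ≤ r ∧ f r = s := by
  obtain ⟨c₁, hc₁, c₂, -, hcomp⟩ := hf.comparable
  obtain ⟨ra, -, hra⟩ := hasBasis_cobounded_norm.eventually_iff.1 hcomp
  obtain ⟨rb, -, hrb⟩ := hHW.exists_log_le 1
  obtain ⟨rc, hrc⟩ := eventually_atTop.1 hf.differentiable
  obtain ⟨C, hC, hCd⟩ := exists_forall_lt_of_limsup_lt_top hf.doubling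
  obtain ⟨s₀, hs₀⟩ := eventually_atTop.1 hCd
  have hlog : ∀ r, max (max ra rb) 0 ≤ r → c₁ * Real.log (1 + r) ≤ f r := by
    intro r hr
    obtain ⟨ξ, rfl⟩ := exists_norm_eq_of_one_le (d := d) hd ((le_max_right _ _).trans hr)
    have h1 := hra (((le_max_left _ _).trans (le_max_left _ _)).trans hr)
    have h2 := hrb ξ (((le_max_right _ _).trans (le_max_left _ _)).trans hr)
    calc c₁ * Real.log (1 + ‖ξ‖) ≤ c₁ * (Φ ξ).re := by gcongr; linarith
      _ ≤ _ := h1.1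
  have htop : Tendsto f atTop atTop := by
    refine tendsto_atTop_mono' atTop ((eventually_ge_atTop _).mono hlog) ?_
    exact (Real.tendsto_log_atTop.comp
      (tendsto_atTop_add_const_left _ 1 tendsto_id)).const_mul_atTop hc₁
  obtain ⟨r₁, hr₁⟩ := eventually_atTop.1 ((htop.eventually_ge_atTop (max s₀ 1)).and
    (eventually_ge_atTop (max (max b rc) 1)))
  obtain ⟨h1, h2⟩ := hr₁ r₁ le_rfl
  have hr₁0 : 0 < r₁ := one_pos.trans_le ((le_max_right _ _).trans h2)
  have hsurj : ∀ s, f r₁ ≤ s → ∃ r, r₁ ≤ r ∧ f r = s := by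
    intro s hs
    obtain ⟨r₂, hr₂, hr₂'⟩ := ((htop.eventually_ge_atTop s).and (eventually_ge_atTop r₁)).exists
    have hcont : ContinuousOn f (Set.Icc r₁ r₂) := fun r hr =>
      (hrc r (((le_max_right b rc).trans ((le_max_left _ _).trans h2)).trans
        hr.1)).continuousAt.continuousWithinAt
    obtain ⟨r, hr, hrs⟩ := intermediate_value_Icc hr₂' hcont ⟨hs, hr₂⟩
    exact ⟨r, hr.1, hrs⟩
  have hfr₁ : 1 ≤ f r₁ := (le_max_right _ _).trans h1
  refine ⟨C, r₁, hC, (le_max_left _ _).trans ((le_max_left _ _).trans h2), hr₁0,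
    one_pos.trans_le hfr₁, fun r hr => ?_, hsurj⟩
  have hr0 : 0 < r := hr₁0.trans_le hr
  have hfr : f r₁ ≤ f r := hf.strictMono.monotoneOn hr₁0.le hr0.le hr
  obtain ⟨r', hr', hfr'⟩ := hsurj (2 * f r) (by linarith)
  have h3 := hs₀ (f r) (((le_max_left _ _).trans h1).trans hfr)
  rw [← hfr', rayInv_apply hf.strictMono hr0.le, rayInv_apply hf.strictMono (hr₁0.le.trans hr'),
    div_lt_iff₀ hr0] at h3
  rw [← hfr']
  exact hf.strictMono.monotoneOn (hr₁0.le.trans hr') (Set.mem_Ici.2 (by positivity)) h3.le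

/-- The inversion of the doubling condition now needs small positive values of `f`. Comparison with
`Re Φ ≥ 0` and strict monotonicity make `f` positive on `(0, ∞)`, and `Re Φ → 0` makes it
arbitrarily small near zero. -/
lemma ControlsAtZero.exists_doubling (hd : 1 ≤ d) {f : ℝ → ℝ} (hf : ControlsAtZero Φ f)
    (hnn : ∀ ξ, 0 ≤ (Φ ξ).re) (hlim : Tendsto (fun ξ => (Φ ξ).re) (𝓝 0) (𝓝 0)) {b : ℝ}
    (hb : 0 < b) :
    ∃ C r₁, 1 < C ∧ r₁ ≤ b ∧ 0 < r₁ ∧ (∀ r, 0 < r → 0 < f r) ∧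
      (∀ r, 0 < r → r ≤ r₁ → 2 * f r ≤ f (C * r)) ∧
      ∀ s, 0 < s → s ≤ f r₁ → ∃ r, 0 < r ∧ r ≤ r₁ ∧ f r = s := by
  obtain ⟨c₁, hc₁, c₂, hc₂, hcomp⟩ := hf.comparable
  obtain ⟨C, hC, hCd⟩ := exists_forall_lt_of_limsup_lt_top hf.doubling
  obtain ⟨s₀, hs₀0, hs₀⟩ := mem_nhdsGT_iff_exists_Ioo_subset.1 hCd
  obtain ⟨δ, hδ0, hδ⟩ := mem_nhdsGT_iff_exists_Ioo_subset.1 hf.differentiable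
  obtain ⟨ε, hε0, hε⟩ := Metric.mem_nhdsWithin_iff.1 hcomp
  have hcmp : ∀ r, 0 < r → r < ε → ∃ ξ : EuclideanSpace ℝ (Fin d), ‖ξ‖ = r ∧
      c₁ * (Φ ξ).re ≤ f r ∧ f r ≤ c₂ * (Φ ξ).re := by
    intro r hr0 hr
    obtain ⟨ξ, rfl⟩ := exists_norm_eq_of_one_le (d := d) hd hr0.le
    exact ⟨ξ, rfl, hε ⟨by simpa using hr, norm_pos_iff.1 hr0⟩⟩
  have hpos : ∀ r, 0 < r → 0 < f r := by
    intro r hr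
    have hm : 0 < min (r / 2) (ε / 2) := by
      have : 0 < ε := hε0
      positivity
    obtain ⟨ξ, -, h1, -⟩ := hcmp (min (r / 2) (ε / 2)) hm
      ((min_le_right _ _).trans_lt (half_lt_self hε0))
    refine (mul_nonneg hc₁.le (hnn ξ)).trans_lt (h1.trans_lt ?_)
    exact hf.strictMono hm.le hr.le ((min_le_left _ _).trans_lt (half_lt_self hr))
  have hsmall : ∀ s, 0 < s → ∀ r, 0 < r → ∃ r', 0 < r' ∧ r' ≤ r ∧ f r' < s := by
    intro s hs r hr
    obtain ⟨η, hη0, hη⟩ := Metric.eventually_nhds_iff.1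
      (hlim.eventually (gt_mem_nhds (div_pos hs hc₂)))
    have hε0' : 0 < ε := hε0
    have hm : 0 < min (min r (ε / 2)) (η / 2) := by positivity
    obtain ⟨ξ, h0, -, h2⟩ := hcmp (min (min r (ε / 2)) (η / 2)) hm
      (((min_le_left _ _).trans (min_le_right _ _)).trans_lt (half_lt_self hε0))
    refine ⟨_, hm, (min_le_left _ _).trans (min_le_left _ _), h2.trans_lt ?_⟩
    have h3 : (Φ ξ).re < s / c₂ := by
      refine hη ?_
      rw [dist_zero_right, h0]
      exact (min_le_right _ _).trans_lt (half_lt_self hη0)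
    rw [lt_div_iff₀ hc₂] at h3
    linarith
  have hsurj : ∀ r₁, 0 < r₁ → r₁ < δ → ∀ s, 0 < s → s ≤ f r₁ → ∃ r, 0 < r ∧ r ≤ r₁ ∧ f r = s := by
    intro r₁ hr₁ hr₁δ s hs hsr
    obtain ⟨r', hr'0, hr', hfr'⟩ := hsmall s hs r₁ hr₁
    have hcont : ContinuousOn f (Set.Icc r' r₁) := fun r hr =>
      DifferentiableAt.continuousAt
        (hδ ⟨hr'0.trans_le hr.1, hr.2.trans_lt hr₁δ⟩) |>.continuousWithinAt
    obtain ⟨r, hr, hrs⟩ := intermediate_value_Icc hr' hcont ⟨hfr'.le, hsr⟩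
    exact ⟨r, hr'0.trans_le hr.1, hr.2, hrs⟩
  have hδ0' : 0 < δ := hδ0
  have hfδ : 0 < f (δ / 2) := hpos _ (by positivity)
  have hs₀0' : 0 < s₀ := hs₀0
  -- For `r ≤ r₁`, `f r < s₀` places `f r` where the doubling bound holds, and `2 * f r < f (δ / 2)`
  -- keeps `2 * f r` among the values attained on `(0, δ / 2]`.
  obtain ⟨r₁, hr₁0, hr₁, hfr₁⟩ := hsmall (min s₀ (f (δ / 2) / 2)) (by positivity)
    (min b (δ / 2)) (by positivity)
  have hr₁δ : r₁ < δ := (hr₁.trans (min_le_right _ _)).trans_lt (half_lt_self hδ0')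
  refine ⟨C, r₁, hC, hr₁.trans (min_le_left _ _), hr₁0, hpos, fun r hr0 hr => ?_,
    hsurj r₁ hr₁0 hr₁δ⟩
  have hfr : f r ≤ f r₁ := hf.strictMono.monotoneOn hr0.le hr₁0.le hr
  have hfr0 := hpos r hr0
  obtain ⟨r', hr'0, -, hfr'⟩ := hsurj (δ / 2) (by positivity) (half_lt_self hδ0') (2 * f r)
    (by positivity) (by linarith [hfr₁.trans_le (min_le_right s₀ (f (δ / 2) / 2))])
  have h3 : rayInv f (2 * f r) / rayInv f (f r) < C :=
    hs₀ ⟨hfr0, hfr.trans_lt (hfr₁.trans_le (min_le_left _ _))⟩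
  rw [← hfr', rayInv_apply hf.strictMono hr0.le, rayInv_apply hf.strictMono hr'0.le,
    div_lt_iff₀ hr0] at h3
  rw [← hfr']
  exact hf.strictMono.monotoneOn hr'0.le (Set.mem_Ici.2 (by positivity)) h3.le

lemma HasSymbol.norm_charFun {Ω : Type*} [MeasurableSpace Ω] {P : Measure Ω}
    {X : ℝ≥0 → Ω → EuclideanSpace ℝ (Fin d)} (hΦ : HasSymbol P X Φ) (t : ℝ≥0)
    (ξ : EuclideanSpace ℝ (Fin d)) :
    ‖charFun (P.map (X t)) ξ‖ = Real.exp (-(t * (Φ ξ).re)) := by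
  have e : (-((t : ℝ) : ℂ) * Φ ξ).re = -(t * (Φ ξ).re) := by
    rw [← Complex.ofReal_neg, Complex.re_ofReal_mul, neg_mul]
  rw [hΦ, Complex.norm_exp, e]

/-- `Re Φ` is minus the logarithm of the modulus of a characteristic function, which is continuous
with value one at zero. -/
lemma HasSymbol.tendsto_re {Ω : Type*} [MeasurableSpace Ω] {P : Measure Ω}
    [IsProbabilityMeasure P] {X : ℝ≥0 → Ω → EuclideanSpace ℝ (Fin d)} (hΦ : HasSymbol P X Φ)
    (hX : Measurable (X 1)) : Tendsto (fun ξ => (Φ ξ).re) (𝓝 0) (𝓝 0) := by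
  have : IsProbabilityMeasure (P.map (X 1)) := Measure.isProbabilityMeasure_map hX.aemeasurable
  have h1 : (fun ξ => (Φ ξ).re) = fun ξ => -Real.log ‖charFun (P.map (X 1)) ξ‖ := by
    ext ξ
    rw [hΦ.norm_charFun, Real.log_exp]
    simp
  rw [h1]
  have h2 : Tendsto (fun ξ => ‖charFun (P.map (X 1)) ξ‖) (𝓝 0) (𝓝 1) := by
    have := (continuous_charFun (μ := P.map (X 1))).norm.tendsto 0
    simpa [charFun_zero] using this
  simpa using (h2.log one_ne_zero).neg

/-- A symbol with logarithmic growth at infinity is bounded away from zero outside of balls. -/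
lemma exists_pos_le_re_levySymbol {ν : Measure (EuclideanSpace ℝ (Fin d))}
    (hν : IsLevyMeasure ν) (hHW : HartmanWintner (levySymbol ν)) {r₁ : ℝ} (hr₁ : 0 < r₁) :
    ∃ a, 0 < a ∧ ∀ ξ, r₁ ≤ ‖ξ‖ → a ≤ (levySymbol ν ξ).re := by
  obtain ⟨r, hr0, hr⟩ := hHW.exists_log_le 1
  -- Multiplication by `n` takes every `ξ` with `‖ξ‖ ≥ r₁` to where the logarithmic bound holds;
  -- coming back costs `n²`.
  obtain ⟨n, hn⟩ := exists_nat_gt (r / r₁)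
  have hn0 : (0 : ℝ) < n := lt_of_le_of_lt (by positivity) hn
  rw [div_lt_iff₀ hr₁] at hn
  have hlog : 0 < Real.log (1 + r) := Real.log_pos (by linarith)
  refine ⟨Real.log (1 + r) / n ^ 2, by positivity, fun ξ hξ => ?_⟩
  have hnorm : r ≤ ‖(n : ℝ) • ξ‖ := by
    rw [norm_smul, Real.norm_of_nonneg hn0.le]
    exact hn.le.trans (by gcongr)
  have h1 := hr _ hnorm
  have h2 := hν.re_levySymbol_nat_smul_le n ξ
  have h3 : Real.log (1 + r) ≤ Real.log (1 + ‖(n : ℝ) • ξ‖) :=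
    Real.log_le_log (by linarith) (by linarith)
  rw [div_le_iff₀' (by positivity)]
  linarith

/-- The Hartman–Wintner condition with constant `m / c` gives `e^{-c Re Φ} ≤ (1 + ‖ξ‖)^{-m}` far
out; on the remaining ball `Re Φ ≥ 0` suffices. -/
lemma exists_exp_neg_mul_pow_le {ν : Measure (EuclideanSpace ℝ (Fin d))}
    (hν : IsLevyMeasure ν) (hHW : HartmanWintner (levySymbol ν)) {c : ℝ} (hc : 0 < c) (m : ℕ) :
    ∃ K, ∀ ξ, Real.exp (-(c * (levySymbol ν ξ).re)) * (1 + ‖ξ‖) ^ m ≤ K := by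
  obtain ⟨r, hr0, hr⟩ := hHW.exists_log_le (m / c)
  refine ⟨(1 + r) ^ m, fun ξ => ?_⟩
  rcases le_total r ‖ξ‖ with h | h
  · have h1 := hr ξ h
    rw [div_mul_eq_mul_div, div_le_iff₀' hc] at h1
    calc _ ≤ Real.exp (-(m * Real.log (1 + ‖ξ‖))) * (1 + ‖ξ‖) ^ m := by gcongr
      _ = 1 := by
          rw [Real.exp_neg, ← Real.log_pow, Real.exp_log (by positivity),
            inv_mul_cancel₀ (by positivity)]
      _ ≤ _ := one_le_pow₀ (by linarith)
  · have h1 : Real.exp (-(c * (levySymbol ν ξ).re)) ≤ 1 :=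
      Real.exp_le_one_iff.2 (by have := hν.re_levySymbol_nonneg ξ; nlinarith)
    calc _ ≤ 1 * (1 + r) ^ m := by gcongr
      _ = _ := one_mul _

end Asymptotics

/-! ### The symbol at the scale `f⁻¹(1/t)` -/

section SymbolScaling

variable {d : ℕ} {ν : Measure (EuclideanSpace ℝ (Fin d))}

lemma one_add_norm_pow_le {ξ : EuclideanSpace ℝ (Fin d)} (hξ : 1 ≤ ‖ξ‖) (m : ℕ) :
    (1 + ‖ξ‖) ^ m ≤ 2 ^ m * ‖ξ‖ ^ m := by
  rw [← mul_pow]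
  gcongr
  linarith

lemma IsLevyMeasure.exp_neg_mul_pow_le_of_norm_le_one (hν : IsLevyMeasure ν) {t R : ℝ}
    (ht : 0 ≤ t) {ξ : EuclideanSpace ℝ (Fin d)} (hξ : ‖ξ‖ ≤ 1) (m : ℕ) :
    Real.exp (-(t * (levySymbol ν (R • ξ)).re)) * (1 + ‖ξ‖) ^ m ≤ 2 ^ m := by
  have h1 : Real.exp (-(t * (levySymbol ν (R • ξ)).re)) ≤ 1 :=
    Real.exp_le_one_iff.2 (neg_nonpos.2 (mul_nonneg ht (hν.re_levySymbol_nonneg _)))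
  calc Real.exp (-(t * (levySymbol ν (R • ξ)).re)) * (1 + ‖ξ‖) ^ m ≤ 1 * (1 + 1) ^ m := by gcongr
    _ = 2 ^ m := by norm_num

/-- For `s ≥ s₀`, the scale `R = f⁻¹(s)` controls the symbol from above and from below. -/
lemma ControlsAtInfinity.exists_scale_bounds (hd : 1 ≤ d) (hν : IsLevyMeasure ν)
    (hHW : HartmanWintner (levySymbol ν)) {f : ℝ → ℝ}
    (hf : ControlsAtInfinity (levySymbol ν) f) (m : ℕ) :
    ∃ s₀ A K : ℝ, 0 < s₀ ∧ ∀ t : ℝ, 0 < t → t ≤ s₀⁻¹ → 0 < rayInv f (1 / t) ∧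
      (∀ ξ, ‖ξ‖ ≤ 1 → t * (levySymbol ν (rayInv f (1 / t) • ξ)).re ≤ A) ∧
      ∀ ξ, Real.exp (-(t * (levySymbol ν (rayInv f (1 / t) • ξ)).re)) * (1 + ‖ξ‖) ^ m ≤ K := by
  obtain ⟨c₁, hc₁, c₂, hc₂, hcomp⟩ := hf.comparable
  obtain ⟨ra, -, hra⟩ := hasBasis_cobounded_norm.eventually_iff.1 hcomp
  obtain ⟨C, r₁, hC, hr₁a, hr₁, hfr₁, hdbl, hsurj⟩ := hf.exists_doubling hd hHW ra
  have hcmp : ∀ ξ : EuclideanSpace ℝ (Fin d), r₁ ≤ ‖ξ‖ →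
      c₁ * (levySymbol ν ξ).re ≤ f ‖ξ‖ ∧ f ‖ξ‖ ≤ c₂ * (levySymbol ν ξ).re := fun ξ h =>
    hra (x := ξ) (hr₁a.trans h)
  obtain ⟨K, hK⟩ := exists_exp_neg_mul_pow_le_of_doubling hC (inv_pos.2 hc₂) m
  obtain ⟨I, hI0, hI⟩ : ∃ I, 0 ≤ I ∧ ∀ ξ, (levySymbol ν ξ).re ≤ (2 + ‖ξ‖ ^ 2) * I :=
    ⟨_, IsLevyMeasure.integral_min_nonneg, hν.re_levySymbol_le⟩
  -- The first summand of `A` serves `‖R • ξ‖ ≥ r₁`, where `Re Φ ≤ f R / c₁`; the second serves `‖R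
  -- • ξ‖ ≤ r₁`, where `Re Φ` is bounded and `t ≤ (f r₁)⁻¹`. In the decay bound, `2 ^ m` serves `‖ξ‖
  -- ≤ 1` and `2 ^ m * K` the rest.
  refine ⟨f r₁, c₁⁻¹ + (f r₁)⁻¹ * ((2 + r₁ ^ 2) * I), max (2 ^ m) (2 ^ m * K), hfr₁,
    fun t ht0 ht => ?_⟩
  obtain ⟨R, hR, hfR⟩ := hsurj (1 / t) (by
    rw [one_div]
    exact (le_inv_comm₀ hfr₁ ht0).2 ht)
  have hR0 : 0 < R := hr₁.trans_le hR
  have hfR0 : 0 < f R := by rw [hfR]; positivity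
  have ht' : t = (f R)⁻¹ := by rw [hfR, one_div, inv_inv]
  rw [← hfR, rayInv_apply hf.strictMono hR0.le]
  have hnorm : ∀ ξ : EuclideanSpace ℝ (Fin d), ‖R • ξ‖ = R * ‖ξ‖ := fun ξ => by
    rw [norm_smul, Real.norm_of_nonneg hR0.le]
  refine ⟨hR0, fun ξ hξ => ?_, fun ξ => ?_⟩
  · have hle : ‖R • ξ‖ ≤ R := by
      rw [hnorm]
      exact mul_le_of_le_one_right hR0.le hξ
    rcases le_total r₁ ‖R • ξ‖ with h | h
    · have h1 := (hcmp (R • ξ) h).1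
      have h2 : f ‖R • ξ‖ ≤ f R := hf.strictMono.monotoneOn
        (Set.mem_Ici.2 (norm_nonneg (R • ξ))) (Set.mem_Ici.2 hR0.le) hle
      have h3 : t * (levySymbol ν (R • ξ)).re ≤ c₁⁻¹ := by
        rw [ht', inv_mul_le_iff₀ hfR0, ← div_eq_mul_inv, le_div_iff₀' hc₁]
        exact h1.trans h2
      have h4 : 0 ≤ (f r₁)⁻¹ * ((2 + r₁ ^ 2) * I) := by positivity
      linarith
    · have h2 : (levySymbol ν (R • ξ)).re ≤ (2 + r₁ ^ 2) * I := (hI _).trans (by gcongr)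
      have h3 : t * (levySymbol ν (R • ξ)).re ≤ (f r₁)⁻¹ * ((2 + r₁ ^ 2) * I) :=
        mul_le_mul ht h2 (hν.re_levySymbol_nonneg _) (by positivity)
      have h4 : 0 ≤ c₁⁻¹ := by positivity
      linarith
  · rcases le_total ‖ξ‖ 1 with hξ | hξ
    · exact (hν.exp_neg_mul_pow_le_of_norm_le_one ht0.le hξ m).trans (le_max_left _ _)
    · have hRξ : R ≤ R * ‖ξ‖ := le_mul_of_one_le_right hR0.le hξ
      have h1 := (hcmp (R • ξ) (by rw [hnorm]; exact hR.trans hRξ)).2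
      rw [hnorm] at h1
      have h2 := hK f R (R * ‖ξ‖) hf.strictMono.monotoneOn hR0 hfR0 hRξ
        fun r' hr' _ => hdbl r' (hR.trans hr')
      rw [mul_div_cancel_left₀ _ hR0.ne'] at h2
      have h3 : c₂⁻¹ * (f (R * ‖ξ‖) / f R) ≤ t * (levySymbol ν (R • ξ)).re := by
        rw [ht', inv_mul_le_iff₀ hc₂, div_le_iff₀ hfR0]
        refine h1.trans_eq ?_
        field_simp
      calc _ ≤ Real.exp (-(c₂⁻¹ * (f (R * ‖ξ‖) / f R))) * (2 ^ m * ‖ξ‖ ^ m) := by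
            gcongr
            exact one_add_norm_pow_le hξ m
        _ = 2 ^ m * (Real.exp (-(c₂⁻¹ * (f (R * ‖ξ‖) / f R))) * ‖ξ‖ ^ m) := by ring
        _ ≤ 2 ^ m * K := by gcongr
        _ ≤ _ := le_max_right _ _

/-- For small `s`, the scale `R = f⁻¹(s)` controls the symbol from above and from below. -/
lemma ControlsAtZero.exists_scale_bounds (hd : 1 ≤ d) (hν : IsLevyMeasure ν)
    (hHW : HartmanWintner (levySymbol ν))
    (hlim : Tendsto (fun ξ => (levySymbol ν ξ).re) (𝓝 0) (𝓝 0)) {f : ℝ → ℝ}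
    (hf : ControlsAtZero (levySymbol ν) f) (m : ℕ) :
    ∃ s₀ A K : ℝ, 0 < s₀ ∧ ∀ t : ℝ, s₀⁻¹ ≤ t → 0 < rayInv f (1 / t) ∧
      (∀ ξ, ‖ξ‖ ≤ 1 → t * (levySymbol ν (rayInv f (1 / t) • ξ)).re ≤ A) ∧
      ∀ ξ, Real.exp (-(t * (levySymbol ν (rayInv f (1 / t) • ξ)).re)) * (1 + ‖ξ‖) ^ m ≤ K := by
  obtain ⟨c₁, hc₁, c₂, hc₂, hcomp⟩ := hf.comparable
  obtain ⟨ε, hε0, hε⟩ := Metric.mem_nhdsWithin_iff.1 hcomp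
  obtain ⟨C, r₁, hC, hr₁ε, hr₁, hpos, hdbl, hsurj⟩ :=
    hf.exists_doubling hd hν.re_levySymbol_nonneg hlim (half_pos hε0)
  have hcmp : ∀ ξ : EuclideanSpace ℝ (Fin d), 0 < ‖ξ‖ → ‖ξ‖ ≤ r₁ →
      c₁ * (levySymbol ν ξ).re ≤ f ‖ξ‖ ∧ f ‖ξ‖ ≤ c₂ * (levySymbol ν ξ).re := fun ξ h0 h1 =>
    hε ⟨by simpa using (h1.trans hr₁ε).trans_lt (half_lt_self hε0), norm_pos_iff.1 h0⟩
  have hfr₁ : 0 < f r₁ := hpos r₁ hr₁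
  -- Comparability with `f` is lost beyond `r₁`. There `K₂` will bound the loss `(r₁ / R) ^ m` and
  -- `K₃` the growth of `(1 + ‖R • ξ‖) ^ m`.
  obtain ⟨a, ha, hal⟩ := exists_pos_le_re_levySymbol hν hHW hr₁
  obtain ⟨K, hK⟩ := exists_exp_neg_mul_pow_le_of_doubling hC (inv_pos.2 hc₂) m
  obtain ⟨K₂, hK₂⟩ := exists_exp_neg_mul_pow_le_of_doubling hC
    (c := a / (2 * f r₁)) (by positivity) m
  obtain ⟨K₃, hK₃⟩ := exists_exp_neg_mul_pow_le hν hHW (c := (f r₁)⁻¹ / 2) (by positivity) m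
  refine ⟨f r₁, c₁⁻¹, max (2 ^ m) (max (2 ^ m * K) (2 ^ m * (K₂ * K₃) / r₁ ^ m)), hfr₁,
    fun t ht => ?_⟩
  have ht0 : 0 < t := (inv_pos.2 hfr₁).trans_le ht
  obtain ⟨R, hR0, hR, hfR⟩ := hsurj (1 / t) (by positivity) (by
    rw [one_div]
    exact inv_le_of_inv_le₀ hfr₁ ht)
  have hfR0 : 0 < f R := by rw [hfR]; positivity
  have ht' : t = (f R)⁻¹ := by rw [hfR, one_div, inv_inv]
  rw [← hfR, rayInv_apply hf.strictMono hR0.le]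
  have hnorm : ∀ ξ : EuclideanSpace ℝ (Fin d), ‖R • ξ‖ = R * ‖ξ‖ := fun ξ => by
    rw [norm_smul, Real.norm_of_nonneg hR0.le]
  refine ⟨hR0, fun ξ hξ => ?_, fun ξ => ?_⟩
  · rcases eq_or_ne ξ 0 with rfl | hξ0
    · have h0 : (levySymbol ν (0 : EuclideanSpace ℝ (Fin d))).re = 0 := by
        simp [hν.re_levySymbol]
      rw [smul_zero, h0, mul_zero]
      positivity
    · have hle : ‖R • ξ‖ ≤ R := by
        rw [hnorm]
        exact mul_le_of_le_one_right hR0.le hξ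
      have h1 := (hcmp (R • ξ) (norm_pos_iff.2 (smul_ne_zero hR0.ne' hξ0)) (hle.trans hR)).1
      have h2 : f ‖R • ξ‖ ≤ f R := hf.strictMono.monotoneOn
        (Set.mem_Ici.2 (norm_nonneg (R • ξ))) (Set.mem_Ici.2 hR0.le) hle
      rw [ht', inv_mul_le_iff₀ hfR0, ← div_eq_mul_inv, le_div_iff₀' hc₁]
      exact h1.trans h2
  · rcases le_total ‖ξ‖ 1 with hξ | hξ
    · exact (hν.exp_neg_mul_pow_le_of_norm_le_one ht0.le hξ m).trans (le_max_left _ _)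
    refine le_trans ?_ (le_max_right _ _)
    have hRξ : R ≤ R * ‖ξ‖ := le_mul_of_one_le_right hR0.le hξ
    rcases le_total (R * ‖ξ‖) r₁ with h | h
    · refine le_trans ?_ (le_max_left _ _)
      have h1 := (hcmp (R • ξ) (by rw [hnorm]; exact hR0.trans_le hRξ) (by rwa [hnorm])).2
      rw [hnorm] at h1
      have h2 := hK f R (R * ‖ξ‖) hf.strictMono.monotoneOn hR0 hfR0 hRξ
        fun r' hr' hr'' => hdbl r' (hR0.trans_le hr') (hr''.trans h)
      rw [mul_div_cancel_left₀ _ hR0.ne'] at h2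
      have h3 : c₂⁻¹ * (f (R * ‖ξ‖) / f R) ≤ t * (levySymbol ν (R • ξ)).re := by
        rw [ht', inv_mul_le_iff₀ hc₂, div_le_iff₀ hfR0]
        refine h1.trans_eq ?_
        field_simp
      calc _ ≤ Real.exp (-(c₂⁻¹ * (f (R * ‖ξ‖) / f R))) * (2 ^ m * ‖ξ‖ ^ m) := by
            gcongr
            exact one_add_norm_pow_le hξ m
        _ = 2 ^ m * (Real.exp (-(c₂⁻¹ * (f (R * ‖ξ‖) / f R))) * ‖ξ‖ ^ m) := by ring
        _ ≤ 2 ^ m * K := by gcongr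
    · refine le_trans ?_ (le_max_right _ _)
      -- The exponent `t * q` is split in half. In one half `q ≥ a` and `t = (f R)⁻¹` give a
      -- multiple of `f r₁ / f R`, which beats `(r₁ / R) ^ m` by doubling up to `r₁`. In the other
      -- `t ≥ (f r₁)⁻¹` leaves a fixed multiple of `q`, which beats `(1 + ‖R • ξ‖) ^ m`.
      set q : ℝ := (levySymbol ν (R • ξ)).re with hq
      have hq0 : 0 ≤ q := hν.re_levySymbol_nonneg _
      have h1 : a ≤ q := hal _ (by rwa [hnorm])
      have h2 := hK₂ f R r₁ hf.strictMono.monotoneOn hR0 hfR0 hR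
        fun r' hr' hr'' => hdbl r' (hR0.trans_le hr') hr''
      have h3 := hK₃ (R • ξ)
      rw [← hq] at h3
      have h4 : a / (2 * f r₁) * (f r₁ / f R) ≤ t / 2 * q := by
        calc _ = t / 2 * a := by rw [ht']; field_simp
          _ ≤ _ := by gcongr
      have h5 : (f r₁)⁻¹ / 2 * q ≤ t / 2 * q := by gcongr
      have h6 : ‖ξ‖ ≤ r₁ / R * (1 + ‖R • ξ‖) / r₁ := by
        rw [hnorm]
        calc ‖ξ‖ = r₁ / R * (R * ‖ξ‖) / r₁ := by field_simp
          _ ≤ _ := by gcongr; linarith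
      have hK₂0 : 0 ≤ K₂ := le_trans (by positivity) h2
      have hK₃0 : 0 ≤ K₃ := le_trans (by positivity) h3
      calc Real.exp (-(t * q)) * (1 + ‖ξ‖) ^ m
          ≤ Real.exp (-(t * q)) * (2 ^ m * (r₁ / R * (1 + ‖R • ξ‖) / r₁) ^ m) := by
            gcongr
            exact (one_add_norm_pow_le hξ m).trans (by gcongr)
        _ = 2 ^ m * ((Real.exp (-(t / 2 * q)) * (r₁ / R) ^ m) *
              (Real.exp (-(t / 2 * q)) * (1 + ‖R • ξ‖) ^ m)) / r₁ ^ m := by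
            rw [show -(t * q) = -(t / 2 * q) + -(t / 2 * q) by ring, Real.exp_add, div_pow,
              mul_pow]
            ring
        _ ≤ 2 ^ m * ((Real.exp (-(a / (2 * f r₁) * (f r₁ / f R))) * (r₁ / R) ^ m) *
              (Real.exp (-((f r₁)⁻¹ / 2 * q)) * (1 + ‖R • ξ‖) ^ m)) / r₁ ^ m := by
            gcongr
        _ ≤ _ := by gcongr

end SymbolScaling

/-! ### The gradient estimates for small and for large times -/

theorem theorem1p3 {d : ℕ} (hd : 1 ≤ d)
    {Ω : Type*} [MeasurableSpace Ω] (P : Measure Ω) [IsProbabilityMeasure P]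
    (ν : Measure (EuclideanSpace ℝ (Fin d))) (hν : IsLevyMeasure ν)
    (X : ℝ≥0 → Ω → EuclideanSpace ℝ (Fin d)) (hX : IsLevyProcess P X)
    (hΦ : HasSymbol P X (levySymbol ν))
    (hHW : HartmanWintner (levySymbol ν)) :
    (∀ f : ℝ → ℝ, ControlsAtInfinity (levySymbol ν) f →
      ∃ c : ℝ, 0 < c ∧ ∃ t₀ : ℝ≥0, 0 < t₀ ∧ ∀ t : ℝ≥0, 0 < t → t ≤ t₀ →
        ∀ u : EuclideanSpace ℝ (Fin d) → ℝ, IsBoundedBorel u →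
          gradSupNorm (levySemigroup P X t u) ≤
            ENNReal.ofReal c * supNorm u * ENNReal.ofReal (rayInv f (1 / (t : ℝ)))) ∧
    (∀ f : ℝ → ℝ, ControlsAtZero (levySymbol ν) f →
      ∃ c : ℝ, 0 < c ∧ ∃ t₁ : ℝ≥0, 0 < t₁ ∧ ∀ t : ℝ≥0, t₁ ≤ t →
        ∀ u : EuclideanSpace ℝ (Fin d) → ℝ, IsBoundedBorel u →
          gradSupNorm (levySemigroup P X t u) ≤
            ENNReal.ofReal c * supNorm u * ENNReal.ofReal (rayInv f (1 / (t : ℝ)))) := by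
  have hmeas := hX.measurable
  constructor
  · intro f hf
    obtain ⟨s₀, A, K, hs₀, h⟩ := hf.exists_scale_bounds hd hν hHW (2 * d + 3)
    obtain ⟨C, hC0, hC⟩ := exists_gradSupNorm_levySemigroup_le hd P hν hmeas hΦ A K
    refine ⟨C, hC0, Real.toNNReal s₀⁻¹, Real.toNNReal_pos.2 (inv_pos.2 hs₀),
      fun t ht0 ht u hu => ?_⟩
    obtain ⟨hR, hA, hK⟩ := h t ht0 ((Real.le_toNNReal_iff_coe_le (inv_pos.2 hs₀).le).1 ht)
    exact hC t _ hR hA hK u hu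
  · intro f hf
    obtain ⟨s₀, A, K, hs₀, h⟩ :=
      hf.exists_scale_bounds hd hν hHW (hΦ.tendsto_re (hmeas 1)) (2 * d + 3)
    obtain ⟨C, hC0, hC⟩ := exists_gradSupNorm_levySemigroup_le hd P hν hmeas hΦ A K
    refine ⟨C, hC0, Real.toNNReal s₀⁻¹, Real.toNNReal_pos.2 (inv_pos.2 hs₀),
      fun t ht u hu => ?_⟩
    obtain ⟨hR, hA, hK⟩ := h t (Real.toNNReal_le_iff_le_coe.1 ht)
    exact hC t _ hR hA hK u hu
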